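/- Let $\tau=(\tau_0,\tau_1,\dots)$ be a renewal process with law $\mathbf P$: $\tau_0=0$ and the increments $\tau_i-\tau_{i-1}$, $i\ge 1$, are IID positive integer-valued random variables. Let $K(n)=\mathbf P(\tau_1=n)$ and assume that there are constants $c_K>0$ and $\zeta\in(0,1)$ such that $$K(n)=c_K(1+o(1))\exp(-n^{\zeta})\qquad (n\to\infty).$$ Let $\omega=(\omega_1,\omega_2,\dots)$ be a sequence of IID real random variables with law $\mathbb P$, centred, of unit variance and with $\lambda(b):=\log\mathbb E[e^{b\omega_1}]<\infty$ for all $b\in\mathbb R$. Write $\delta_n=\mathbf 1_{\{\exists i:\ \tau_i=n\}}$ and, for $\beta>0$, $h\in\mathbb R$ and $N\ge1$, $$Z_N^{\beta,h,\omega}=\mathbf E\Big[e^{\sum_{n=1}^N(\beta\omega_n+h)\delta_n}\,\delta_N\Big].$$ Then for all $\beta>0$ the following holds. For every $h\in\mathbb R$ the sequence $\frac1N\log Z_N^{\beta,h,\omega}$ converges, for $\mathbb P$-almost every $\omega$, to a finite non-random limit $F(\beta,h)$ as $N\to\infty$; the set $\{h\in\mathbb R : F(\beta,h)>0\}$ is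 non-empty and bounded below; and its infimum, the quenched critical point $h_c(\beta):=\inf\{h : F(\beta,h)>0\}$, satisfies $$h_c(\beta)>-\lambda(\beta).$$ -/

import Mathlib

open MeasureTheory ProbabilityTheory Filter Topology

namespace Pinning

noncomputable section

/-- `τ = (τ 0, τ 1, …)` is a renewal process under `P`: `τ 0 = 0` and the inter-arrival times
`τ (i + 1) - τ i` are IID positive integer-valued random variables. -/
structure IsRenewal {S : Type*} [MeasurableSpace S] (P : Measure S) (τ : ℕ → S → ℕ) : Prop where
  measurable : ∀ i, Measurable (τ i)
  zero : ∀ x, τ 0 x = 0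
  lt_succ : ∀ i x, τ i x < τ (i + 1) x
  indep : iIndepFun (fun (i : ℕ) (x : S) => τ (i + 1) x - τ i x) P
  ident : ∀ i, IdentDistrib (fun x => τ (i + 1) x - τ i x) (fun x => τ 1 x - τ 0 x) P P

/-- The inter-arrival law `K n = P (τ 1 = n)`. -/
def interArrival {S : Type*} [MeasurableSpace S] (P : Measure S) (τ : ℕ → S → ℕ) (n : ℕ) : ℝ :=
  P.real {x | τ 1 x = n}

/-- `K n = c_K (1 + o(1)) exp (- n ^ ζ)` as `n → ∞`, for some `c_K > 0` and `ζ ∈ (0, 1)`. -/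
def StretchedExponential (K : ℕ → ℝ) : Prop :=
  ∃ c > (0 : ℝ), ∃ ζ ∈ Set.Ioo (0 : ℝ) 1,
    Asymptotics.IsEquivalent atTop K (fun n : ℕ => c * Real.exp (-((n : ℝ) ^ ζ)))

/-- `ω 1, ω 2, …` are IID centred random variables of unit variance with exponential moments of
all orders (the value `ω 0` plays no role). -/
structure IsDisorder {Ω : Type*} [MeasurableSpace Ω] (μ : Measure Ω) (ω : ℕ → Ω → ℝ) : Prop where
  measurable : ∀ n, Measurable (ω (n + 1))
  indep : iIndepFun (fun n : ℕ => ω (n + 1)) μ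
  ident : ∀ n, IdentDistrib (ω (n + 1)) (ω 1) μ μ
  mean_zero : ∫ a, ω 1 a ∂μ = 0
  variance_one : variance (ω 1) μ = 1
  integrable_exp : ∀ b : ℝ, Integrable (fun a => Real.exp (b * ω 1 a)) μ

/-- `δ_n`, the indicator of the event `{n ∈ τ} = {∃ i, τ i = n}`. -/
def contact {S : Type*} (τ : ℕ → S → ℕ) (n : ℕ) : S → ℝ :=
  Set.indicator {x | ∃ i, τ i x = n} 1

/-- The partition function with the end point pinned, in the environment `w = (w 1, w 2, …)`:
`Z_N = E [exp (∑_{n=1}^N (β w_n + h) δ_n) δ_N]`, the expectation being that of the renewal. -/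
def partitionFunction {S : Type*} [MeasurableSpace S] (P : Measure S) (τ : ℕ → S → ℕ)
    (β h : ℝ) (w : ℕ → ℝ) (N : ℕ) : ℝ :=
  ∫ x, Real.exp (∑ n ∈ Finset.Icc 1 N, (β * w n + h) * contact τ n x) * contact τ N x ∂P

/-- The non-random number `f` is the free energy `F(β, h)`: almost surely in the environment,
`(1 / N) log Z_N → f` as `N → ∞`. -/
def IsFreeEnergy {S Ω : Type*} [MeasurableSpace S] [MeasurableSpace Ω]
    (P : Measure S) (τ : ℕ → S → ℕ) (μ : Measure Ω) (ω : ℕ → Ω → ℝ) (β h f : ℝ) : Prop :=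
  ∀ᵐ a ∂μ, Tendsto
    (fun N : ℕ => (1 / (N : ℝ)) * Real.log (partitionFunction P τ β h (fun n => ω n a) N))
    atTop (𝓝 f)

/-- The set of all `h` such that `F(β, h) > 0`. -/
def pinnedPhase {S Ω : Type*} [MeasurableSpace S] [MeasurableSpace Ω]
    (P : Measure S) (τ : ℕ → S → ℕ) (μ : Measure Ω) (ω : ℕ → Ω → ℝ) (β : ℝ) : Set ℝ :=
  {h | ∃ f, IsFreeEnergy P τ μ ω β h f ∧ 0 < f}

/-- The quenched critical point `h_c(β) = inf {h | F(β, h) > 0}`. -/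
def criticalPoint {S Ω : Type*} [MeasurableSpace S] [MeasurableSpace Ω]
    (P : Measure S) (τ : ℕ → S → ℕ) (μ : Measure Ω) (ω : ℕ → Ω → ℝ) (β : ℝ) : ℝ :=
  sInf (pinnedPhase P τ μ ω β)

end

end Pinning

/-! At `h = -λ(β)` each contact has averaged weight one, so the averaged partition function is a
renewal mass, bounded but not small. The quenched model is nevertheless strictly less favourable,
and the fractional moment `E √Z` detects this. Tilting the law of `d` sites by `-t` with `t = d ^
(-1/2)` has cost `O(1)`, because the disorder is centred with finite exponential moments. It lowers
the averaged weight of a contact to at most `1 - c t` (`eventually_tilted_le`), since `λ'(β) > 0`.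
As `K` has finite mean, the homogeneous partition function with weight `q < 1` is `O(1 / (d (1 -
q)))` (`mul_pinSum_const_le`), here `O(d ^ (-1/2))`. An AM-GM form of the Cauchy-Schwarz inequality
then gives `E √Z_d = O(d ^ (-1/4))` (`IsDisorder.tendsto_integral_sqrt_pinSum`).

This decay passes to larger `h` by a finite-volume criterion. Cutting at the jump across site `k`
and using subadditivity of the square root, `E √Z_d` is bounded uniformly in `d` once a quantity
built from the first `k` fractional moments and the tails of `√K` is at most one
(`IIDWeights.integral_sqrt_pinSum_le`). The exponent one half is allowed because `√K` is again of
stretched exponential type. At `-λ(β)` the quantity tends to zero as `k → ∞`. For fixed `k` a small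
increase of `h` at most doubles it, so fractional moments stay bounded slightly above `-λ(β)`, and
by Fatou the free energy is not positive there.

The free energy exists because the pinned sum is supermultiplicative and the sum without boundary
costs is submultiplicative, while the two differ by subexponential factors as `ζ < 1`
(`freeSum_le_pinSum`). The strong law on independent blocks then bounds the growth rate on both
sides (`IIDWeights.exists_freeEnergy`). -/

namespace Pinning

/-- The sequence of site weights seen from site `l`. -/
def shiftSeq {α : Type*} (l : ℕ) (y : ℕ → α) : ℕ → α := fun i => y (l + i)

/-- The pinned partition function of the segment `[0, d]`, where site `i + 1` has weight `y i`,
through the decomposition according to the last but one contact. -/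
def pinSum (K y : ℕ → ℝ) : ℕ → ℝ
  | 0 => 1
  | d + 1 => y d * ∑ k : Fin (d + 1), pinSum K y k * K (d + 1 - k)

/-- The sum over configurations with an unweighted first contact and a contact at site `d + 1`. -/
def occSum (K y : ℕ → ℝ) (d : ℕ) : ℝ :=
  y d * (1 + ∑ k : Fin d, occSum K y k * K (d - k))

/-- The partition function of the sites `1, …, n` without boundary cost. -/
def freeSum (K y : ℕ → ℝ) (n : ℕ) : ℝ := 1 + ∑ d ∈ Finset.range n, occSum K y d

/-! ### Recursions and multiplicative inequalities in a fixed environment. -/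

section Deterministic

variable {K y : ℕ → ℝ}

@[simp] lemma pinSum_zero (K y : ℕ → ℝ) : pinSum K y 0 = 1 := by rw [pinSum]

lemma pinSum_succ (K y : ℕ → ℝ) (d : ℕ) :
    pinSum K y (d + 1) = y d * ∑ k ∈ Finset.range (d + 1), pinSum K y k * K (d + 1 - k) := by
  rw [pinSum, Finset.sum_range]

lemma occSum_eq (K y : ℕ → ℝ) (d : ℕ) :
    occSum K y d = y d * (1 + ∑ k ∈ Finset.range d, occSum K y k * K (d - k)) := by
  rw [occSum, Finset.sum_range]

lemma shiftSeq_apply {α : Type*} (l : ℕ) (y : ℕ → α) (i : ℕ) : shiftSeq l y i = y (l + i) := rfl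

@[simp] lemma shiftSeq_zero {α : Type*} (y : ℕ → α) : shiftSeq 0 y = y := by
  funext i; simp [shiftSeq]

lemma pinSum_nonneg (hK : ∀ n, 0 ≤ K n) (hy : ∀ n, 0 ≤ y n) (d : ℕ) : 0 ≤ pinSum K y d := by
  induction d using Nat.strong_induction_on with
  | _ d ih =>
    cases d with
    | zero => simp
    | succ d =>
      rw [pinSum_succ]
      exact mul_nonneg (hy d) (Finset.sum_nonneg fun k hk =>
        mul_nonneg (ih k (Finset.mem_range.1 hk)) (hK _))

lemma occSum_nonneg (hK : ∀ n, 0 ≤ K n) (hy : ∀ n, 0 ≤ y n) (d : ℕ) : 0 ≤ occSum K y d := by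
  induction d using Nat.strong_induction_on with
  | _ d ih =>
    rw [occSum_eq]
    exact mul_nonneg (hy d) (add_nonneg zero_le_one (Finset.sum_nonneg fun k hk =>
      mul_nonneg (ih k (Finset.mem_range.1 hk)) (hK _)))

lemma one_le_freeSum (hK : ∀ n, 0 ≤ K n) (hy : ∀ n, 0 ≤ y n) (n : ℕ) : 1 ≤ freeSum K y n := by
  have := Finset.sum_nonneg (s := Finset.range n) fun d _ => occSum_nonneg hK hy d
  simp only [freeSum]; linarith

lemma freeSum_mono (hK : ∀ n, 0 ≤ K n) (hy : ∀ n, 0 ≤ y n) : Monotone (freeSum K y) := by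
  refine monotone_nat_of_le_succ fun n => ?_
  simp only [freeSum, Finset.sum_range_succ]
  linarith [occSum_nonneg hK hy n]

lemma single_jump_le_pinSum (hK : ∀ n, 0 ≤ K n) (hy : ∀ n, 0 ≤ y n) (d : ℕ) :
    y d * K (d + 1) ≤ pinSum K y (d + 1) := by
  rw [pinSum_succ]
  refine mul_le_mul_of_nonneg_left ?_ (hy d)
  have := Finset.single_le_sum (f := fun k => pinSum K y k * K (d + 1 - k))
    (fun k _ => mul_nonneg (pinSum_nonneg hK hy k) (hK _)) (Finset.mem_range.2 d.succ_pos)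
  simpa using this

lemma pinSum_mono {y' : ℕ → ℝ} (hK : ∀ n, 0 ≤ K n) (hy : ∀ n, 0 ≤ y n) (h : ∀ i, y i ≤ y' i)
    (d : ℕ) : pinSum K y d ≤ pinSum K y' d := by
  induction d using Nat.strong_induction_on with
  | _ d ih =>
    cases d with
    | zero => simp
    | succ d =>
      rw [pinSum_succ, pinSum_succ]
      refine mul_le_mul (h d) (Finset.sum_le_sum fun k hk => ?_)
        (Finset.sum_nonneg fun k _ => mul_nonneg (pinSum_nonneg hK hy k) (hK _))
        ((hy d).trans (h d))
      exact mul_le_mul_of_nonneg_right (ih k (Finset.mem_range.1 hk)) (hK _)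

/-- A configuration on `d` sites has at most `d` contacts, each contributing one factor `a ≥ 1`.
This controls the effect of raising `h`. -/
lemma pinSum_const_mul_le {a : ℝ} (ha : 1 ≤ a) (hK : ∀ n, 0 ≤ K n) (hy : ∀ n, 0 ≤ y n) (d : ℕ) :
    pinSum K (fun i => a * y i) d ≤ a ^ d * pinSum K y d := by
  induction d using Nat.strong_induction_on with
  | _ d ih =>
    cases d with
    | zero => simp
    | succ d =>
      rw [pinSum_succ, pinSum_succ]
      have : ∑ k ∈ Finset.range (d + 1), pinSum K (fun i => a * y i) k * K (d + 1 - k) ≤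
          a ^ d * ∑ k ∈ Finset.range (d + 1), pinSum K y k * K (d + 1 - k) := by
        rw [Finset.mul_sum]
        refine Finset.sum_le_sum fun k hk => ?_
        rw [← mul_assoc]
        refine mul_le_mul_of_nonneg_right ((ih k (Finset.mem_range.1 hk)).trans ?_) (hK _)
        exact mul_le_mul_of_nonneg_right
          (pow_le_pow_right₀ ha (Nat.lt_succ_iff.1 (Finset.mem_range.1 hk)))
          (pinSum_nonneg hK hy k)
      calc a * y d * _ ≤ a * y d * _ :=
            mul_le_mul_of_nonneg_left this (mul_nonneg (zero_le_one.trans ha) (hy d))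
        _ = _ := by ring

/-- Super-multiplicativity of the pinned partition function. -/
lemma pinSum_mul_le (hK : ∀ n, 0 ≤ K n) (hy : ∀ n, 0 ≤ y n) (l d : ℕ) :
    pinSum K y l * pinSum K (shiftSeq l y) d ≤ pinSum K y (l + d) := by
  induction d using Nat.strong_induction_on with
  | _ d ih =>
    cases d with
    | zero => simp
    | succ d =>
      rw [pinSum_succ, ← add_assoc, pinSum_succ, shiftSeq_apply, mul_left_comm]
      refine mul_le_mul_of_nonneg_left ?_ (hy _)
      rw [Finset.mul_sum, add_assoc,
        Finset.sum_range_add (fun k => pinSum K y k * K (l + (d + 1) - k))]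
      refine le_add_of_nonneg_of_le
        (Finset.sum_nonneg fun k _ => mul_nonneg (pinSum_nonneg hK hy k) (hK _))
        (Finset.sum_le_sum fun k hk => ?_)
      rw [← mul_assoc, Nat.add_sub_add_left]
      exact mul_le_mul_of_nonneg_right (ih k (Finset.mem_range.1 hk)) (hK _)

/-- The two sums differ only by the cost of the first jump, which is at most one. -/
lemma pinSum_succ_le_occSum (hK : ∀ n, 0 ≤ K n) (hK1 : ∀ n, K n ≤ 1) (hy : ∀ n, 0 ≤ y n) (d : ℕ) :
    pinSum K y (d + 1) ≤ occSum K y d := by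
  induction d using Nat.strong_induction_on with
  | _ d ih =>
    rw [pinSum_succ, occSum_eq, Finset.sum_range_succ']
    refine mul_le_mul_of_nonneg_left ?_ (hy d)
    rw [add_comm]
    refine add_le_add (by simpa using hK1 _) (Finset.sum_le_sum fun k hk => ?_)
    rw [Nat.add_sub_add_right]
    exact mul_le_mul_of_nonneg_right (ih k (Finset.mem_range.1 hk)) (hK _)

lemma pinSum_le_freeSum (hK : ∀ n, 0 ≤ K n) (hK1 : ∀ n, K n ≤ 1) (hy : ∀ n, 0 ≤ y n) (d : ℕ) :
    pinSum K y d ≤ freeSum K y d := by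
  cases d with
  | zero => simp [freeSum]
  | succ d =>
    refine (pinSum_succ_le_occSum hK hK1 hy d).trans ?_
    rw [freeSum, Finset.sum_range_succ]
    have := Finset.sum_nonneg (s := Finset.range d) fun d _ => occSum_nonneg hK hy d
    linarith

/-- The jump straddling `m` costs at most one and is dropped; what precedes it sums to the free sum
of `m` sites. -/
lemma occSum_add_le (hK : ∀ n, 0 ≤ K n) (hK1 : ∀ n, K n ≤ 1) (hy : ∀ n, 0 ≤ y n) (m j : ℕ) :
    occSum K y (m + j) ≤ freeSum K y m * occSum K (shiftSeq m y) j := by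
  induction j using Nat.strong_induction_on with
  | _ j ih =>
    rw [occSum_eq, occSum_eq, shiftSeq_apply, mul_left_comm]
    refine mul_le_mul_of_nonneg_left ?_ (hy _)
    rw [Finset.sum_range_add, mul_add, ← add_assoc, mul_one, Finset.mul_sum, freeSum]
    refine add_le_add (add_le_add le_rfl (Finset.sum_le_sum fun k _ => ?_))
      (Finset.sum_le_sum fun k hk => ?_)
    · exact mul_le_of_le_one_right (occSum_nonneg hK hy k) (hK1 _)
    · rw [← mul_assoc, Nat.add_sub_add_left]
      exact mul_le_mul_of_nonneg_right (ih k (Finset.mem_range.1 hk)) (hK _)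

/-- Sub-multiplicativity of the partition function without boundary cost. -/
lemma freeSum_add_le (hK : ∀ n, 0 ≤ K n) (hK1 : ∀ n, K n ≤ 1) (hy : ∀ n, 0 ≤ y n) (m n : ℕ) :
    freeSum K y (m + n) ≤ freeSum K y m * freeSum K (shiftSeq m y) n := by
  have h : freeSum K y (m + n) = freeSum K y m + ∑ j ∈ Finset.range n, occSum K y (m + j) := by
    rw [freeSum, Finset.sum_range_add, ← add_assoc, freeSum]
  have h' : freeSum K (shiftSeq m y) n =
    1 + ∑ j ∈ Finset.range n, occSum K (shiftSeq m y) j := rfl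
  rw [h, h', mul_add, mul_one, Finset.mul_sum]
  exact add_le_add le_rfl (Finset.sum_le_sum fun j _ => occSum_add_le hK hK1 hy m j)

/-- Peeling off one site at a time bounds the free sum by a product of factors `1 + y i`. The linear
bound serves to prove integrability. -/
lemma log_freeSum_le (hK : ∀ n, 0 ≤ K n) (hK1 : ∀ n, K n ≤ 1) (hy : ∀ n, 0 ≤ y n) (n : ℕ) :
    Real.log (freeSum K y n) ≤ ∑ i ∈ Finset.range n, y i := by
  induction n with
  | zero => simp [freeSum]
  | succ n ih =>
    have hy' : ∀ i, 0 ≤ shiftSeq n y i := fun i => hy _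
    have h0 := one_le_freeSum hK hy n
    have h1 := one_le_freeSum hK hy' 1
    have h2 : freeSum K (shiftSeq n y) 1 = 1 + y n := by
      rw [freeSum, Finset.sum_range_one, occSum_eq]
      simp [shiftSeq]
    calc Real.log (freeSum K y (n + 1))
        ≤ Real.log (freeSum K y n * freeSum K (shiftSeq n y) 1) :=
          Real.log_le_log (by linarith [one_le_freeSum hK hy (n + 1)])
            (freeSum_add_le hK hK1 hy n 1)
      _ = Real.log (freeSum K y n) + Real.log (1 + y n) := by
          rw [Real.log_mul (by linarith) (by linarith), h2]
      _ ≤ _ := by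
          rw [Finset.sum_range_succ]
          have := Real.log_le_sub_one_of_pos (x := 1 + y n) (by linarith [hy n])
          linarith

/-- A buffer of `p` sites is left before the first contact, so that the missing first jump has
length at least `p`, where `K` is bounded below by `κ`. -/
lemma mul_occSum_le_pinSum {p : ℕ} {κ : ℝ} (hK : ∀ n, 0 ≤ K n)
    (hy : ∀ n, 0 ≤ y n) (d : ℕ) (hκ : ∀ q, p ≤ q → q ≤ p + d + 1 → κ ≤ K q) :
    κ * occSum K (shiftSeq p y) d ≤ pinSum K y (p + 1 + d) := by
  induction d using Nat.strong_induction_on with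
  | _ d ih =>
    rw [occSum_eq, add_right_comm, pinSum_succ, shiftSeq_apply, mul_left_comm]
    refine mul_le_mul_of_nonneg_left ?_ (hy _)
    rw [mul_add, mul_one, Finset.mul_sum, add_right_comm, Finset.sum_range_add]
    refine add_le_add ?_ (Finset.sum_le_sum fun k hk => ?_)
    · have := Finset.single_le_sum (f := fun k => pinSum K y k * K (p + 1 + d - k))
        (fun k _ => mul_nonneg (pinSum_nonneg hK hy k) (hK _)) (Finset.mem_range.2 p.succ_pos)
      refine le_trans ?_ this
      simpa using hκ (p + 1 + d) (by omega) (by omega)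
    · rw [← mul_assoc, Nat.add_sub_add_left]
      have hk' := Finset.mem_range.1 hk
      exact mul_le_mul_of_nonneg_right (ih k hk' fun q h1 h2 => hκ q h1 (by omega)) (hK _)

/-- Restoring the boundary costs in the partition function of `m` sites. -/
lemma freeSum_le_pinSum {p m : ℕ} {κ : ℝ} (hK : ∀ n, 0 ≤ K n) (hy : ∀ n, 0 ≤ y n) (hκ0 : 0 ≤ κ)
    (hκ1 : κ ≤ 1) (hp : 1 ≤ p) (hκ : ∀ q, p ≤ q → q ≤ m + 2 * p → κ ≤ K q) :
    κ ^ 2 * y (m + 2 * p - 1) * freeSum K (shiftSeq p y) m ≤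
      (1 + m) * pinSum K y (m + 2 * p) := by
  obtain ⟨e, he⟩ : ∃ e, m + 2 * p = e + 1 := ⟨m + 2 * p - 1, by omega⟩
  have hpin := pinSum_nonneg hK hy
  rw [he, Nat.add_sub_cancel, freeSum, mul_add, add_mul, one_mul, mul_one, Finset.mul_sum]
  refine add_le_add ?_ ?_
  -- The empty configuration is compared with one jump over the whole segment; `κ ^ 2 ≤ κ` suffices.
  · refine le_trans ?_ (single_jump_le_pinSum hK hy e)
    rw [mul_comm]
    refine mul_le_mul_of_nonneg_left (le_trans ?_ (hκ (e + 1) (by omega) he.ge)) (hy e)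
    nlinarith
  -- With last contact at `p + 1 + d`, both boundary jumps have length at least `p` and cost one `κ`
  -- each. The `m` possible last contacts give the factor `m`.
  · refine (Finset.sum_le_card_nsmul (Finset.range m) _ (pinSum K y (e + 1))
      fun d hd => ?_).trans_eq (by simp)
    have hd' := Finset.mem_range.1 hd
    have h1 := mul_occSum_le_pinSum (κ := κ) (p := p) hK hy d fun q h1 h2 => hκ q h1 (by omega)
    rw [pinSum_succ]
    have h2 : pinSum K y (p + 1 + d) * K (e + 1 - (p + 1 + d)) ≤
        ∑ k ∈ Finset.range (e + 1), pinSum K y k * K (e + 1 - k) :=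
      Finset.single_le_sum (f := fun k => pinSum K y k * K (e + 1 - k))
        (fun k _ => mul_nonneg (hpin k) (hK _)) (Finset.mem_range.2 (by omega))
    have h3 : κ * pinSum K y (p + 1 + d) ≤ pinSum K y (p + 1 + d) * K (e + 1 - (p + 1 + d)) := by
      rw [mul_comm]
      exact mul_le_mul_of_nonneg_left (hκ _ (by omega) (by omega)) (hpin _)
    calc κ ^ 2 * y e * occSum K (shiftSeq p y) d
        = y e * (κ * (κ * occSum K (shiftSeq p y) d)) := by ring
      _ ≤ y e * (κ * pinSum K y (p + 1 + d)) := by gcongr; exact hy e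
      _ ≤ _ := mul_le_mul_of_nonneg_left (h3.trans h2) (hy e)

/-- Decomposition according to the last contact before site `k` and the first one from `k` on. -/
lemma pinSum_add_eq (K y : ℕ → ℝ) {k : ℕ} (hk : 1 ≤ k) (d : ℕ) :
    pinSum K y (k + d) = ∑ j ∈ Finset.range (d + 1),
      (∑ r ∈ Finset.range k, pinSum K y r * K (k + j - r)) * y (k + j - 1) *
        pinSum K (shiftSeq (k + j) y) (d - j) := by
  induction d using Nat.strong_induction_on with
  | _ d ih =>
    cases d with
    | zero =>
      obtain ⟨k, rfl⟩ := Nat.exists_eq_add_of_le' hk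
      simp [pinSum_succ, mul_comm]
    | succ d =>
      set Q : ℕ → ℝ := fun j =>
        (∑ r ∈ Finset.range k, pinSum K y r * K (k + j - r)) * y (k + j - 1) with hQ
      rw [← add_assoc, pinSum_succ, add_assoc, Finset.sum_range_add, Finset.sum_range_succ _
          (d + 1),
        mul_add, add_comm]
      -- If the contact preceding the end lies at `k + e`, the induction hypothesis applies;
      -- otherwise the final jump itself crosses `k`, which is the term `j = d + 1`.
      congr 1
      · have : ∀ e ∈ Finset.range (d + 1), pinSum K y (k + e) * K (k + (d + 1) - (k + e)) =
            ∑ j ∈ Finset.range (e + 1), Q j * (pinSum K (shiftSeq (k + j) y) (e - j)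
              * K (d + 1 - e)) := by
          intro e he
          rw [ih e (Finset.mem_range.1 he), Finset.sum_mul, Nat.add_sub_add_left]
          exact Finset.sum_congr rfl fun j _ => by rw [mul_assoc]
        rw [Finset.sum_congr rfl this]
        rw [Finset.sum_comm' (t' := Finset.range (d + 1)) (s' := fun j => Finset.Ico j (d + 1))
          (by intro e j; simp only [Finset.mem_range, Finset.mem_Ico]; omega), Finset.mul_sum]
        refine Finset.sum_congr rfl fun j hj => ?_
        have hj' := Finset.mem_range.1 hj
        rw [← Finset.mul_sum, mul_left_comm, Finset.sum_Ico_eq_sum_range,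
          show d + 1 - j = (d - j) + 1 by omega, pinSum_succ, shiftSeq_apply,
          show k + j + (d - j) = k + d by omega]
        congr 2
        refine Finset.sum_congr rfl fun i hi => ?_
        congr 2
        · omega
        · have := Finset.mem_range.1 hi; omega
      · rw [Nat.sub_self, pinSum_zero, mul_one, mul_comm]
        rfl

end Deterministic

/-! ### Independence, and the renewal recursion for the partition function. -/

/-- Functions of disjoint sets of coordinates of an independent sequence are independent. -/
lemma indepFun_of_measurable_iSup {Ω E F F' : Type*} [MeasurableSpace Ω] [mE : MeasurableSpace E]
    [MeasurableSpace F] [MeasurableSpace F'] {μ : Measure Ω} {X : ℕ → Ω → E}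
    (hX : ∀ i, Measurable (X i)) (h : iIndepFun X μ) {s t : Set ℕ} (hst : Disjoint s t)
    {f : Ω → F} {g : Ω → F'} (hf : Measurable[⨆ i ∈ s, mE.comap (X i)] f)
    (hg : Measurable[⨆ i ∈ t, mE.comap (X i)] g) : IndepFun f g μ :=
  indep_of_indep_of_le_left (indep_of_indep_of_le_right
    (indep_iSup_of_disjoint (fun i => (hX i).comap_le) h hst) hg.comap_le) hf.comap_le

lemma measurable_coordinate {Ω E : Type*} [mE : MeasurableSpace E] (X : ℕ → Ω → E)
    {s : Set ℕ} {i : ℕ} (hi : i ∈ s) : Measurable[⨆ i ∈ s, mE.comap (X i)] (X i) :=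
  measurable_iff_comap_le.2 (le_iSup₂_of_le i hi le_rfl)

/-- The weight of the event that the `k`-th renewal is at `N`. -/
noncomputable def indexedWeight {S : Type*} (τ : ℕ → S → ℕ) (φ : ℕ → ℝ) (k N : ℕ) (x : S) : ℝ :=
  (∏ i ∈ Finset.range k, φ (τ (i + 1) x)) * Set.indicator {x | τ k x = N} 1 x

lemma measurable_indexedWeight_of_measurable {S : Type*} [MeasurableSpace S] {τ : ℕ → S → ℕ}
    {k : ℕ} (h : ∀ j ≤ k, Measurable (τ j)) (φ : ℕ → ℝ) (N : ℕ) :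
    Measurable (indexedWeight τ φ k N) := by
  refine Measurable.mul (Finset.measurable_fun_prod _ fun i hi => ?_) ?_
  · exact (measurable_from_top (f := φ)).comp (h (i + 1) (Finset.mem_range.1 hi))
  · exact measurable_one.indicator (h k le_rfl (measurableSet_singleton N))

lemma contact_of_exists {S : Type*} {τ : ℕ → S → ℕ} {n : ℕ} {x : S} (h : ∃ i, τ i x = n) :
    contact τ n x = 1 :=
  Set.indicator_of_mem (s := {x | ∃ i, τ i x = n}) h 1

lemma contact_of_not_exists {S : Type*} {τ : ℕ → S → ℕ} {n : ℕ} {x : S} (h : ¬ ∃ i, τ i x = n) :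
    contact τ n x = 0 :=
  Set.indicator_of_notMem (s := {x | ∃ i, τ i x = n}) h 1

section Renewal

variable {S : Type*} [MeasurableSpace S] {P : Measure S} {τ : ℕ → S → ℕ}

lemma IsRenewal.strictMono (hτ : IsRenewal P τ) (x : S) : StrictMono fun i => τ i x :=
  strictMono_nat_of_lt_succ fun i => hτ.lt_succ i x

lemma IsRenewal.measurable_gap (hτ : IsRenewal P τ) (i : ℕ) :
    Measurable fun x => τ (i + 1) x - τ i x :=
  (hτ.measurable (i + 1)).sub (hτ.measurable i)

/-- The gaps are the independent coordinates, so each `τ j` is expressed through the gaps before it.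
-/
lemma IsRenewal.measurable_past (hτ : IsRenewal P τ) (k : ℕ) :
    ∀ j ≤ k, Measurable[⨆ i ∈ Set.Iio k, (inferInstance : MeasurableSpace ℕ).comap
      (fun x => τ (i + 1) x - τ i x)] (τ j) := by
  intro j
  induction j with
  | zero =>
    intro _
    rw [show τ 0 = fun _ => 0 from funext hτ.zero]
    exact measurable_const
  | succ j ih =>
    intro hj
    have h : τ (j + 1) = fun x => τ j x + (τ (j + 1) x - τ j x) := by
      funext x
      have := hτ.lt_succ j x
      omega
    rw [h]
    exact (ih (by omega)).add
      (measurable_coordinate (fun i x => τ (i + 1) x - τ i x) (Set.mem_Iio.2 hj))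

lemma IsRenewal.measurable_indexedWeight (hτ : IsRenewal P τ) (φ : ℕ → ℝ) (k N : ℕ) :
    Measurable[⨆ i ∈ Set.Iio k, (inferInstance : MeasurableSpace ℕ).comap
      (fun x => τ (i + 1) x - τ i x)] (indexedWeight τ φ k N) :=
  @measurable_indexedWeight_of_measurable S (_) τ k (hτ.measurable_past k) φ N

lemma IsRenewal.iSup_gap_le (hτ : IsRenewal P τ) (s : Set ℕ) :
    (⨆ i ∈ s, (inferInstance : MeasurableSpace ℕ).comap (fun x => τ (i + 1) x - τ i x)) ≤
      ‹MeasurableSpace S› :=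
  iSup₂_le fun i _ => (hτ.measurable_gap i).comap_le

/-- On `τ k = N` every visited site is at most `N`, so each factor is bounded by the finite sum of
`φ` up to `N`. -/
lemma IsRenewal.integrable_indexedWeight [IsFiniteMeasure P] (hτ : IsRenewal P τ) {φ : ℕ → ℝ}
    (hφ : ∀ n, 0 ≤ φ n)
    (k N : ℕ) : Integrable (indexedWeight τ φ k N) P := by
  refine Integrable.of_bound
    ((hτ.measurable_indexedWeight φ k N).mono (hτ.iSup_gap_le _) le_rfl).aestronglyMeasurable
    ((∑ m ∈ Finset.range (N + 1), φ m) ^ k) (Eventually.of_forall fun x => ?_)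
  have hB : 0 ≤ ∑ m ∈ Finset.range (N + 1), φ m := Finset.sum_nonneg fun m _ => hφ m
  by_cases hx : τ k x = N
  · rw [indexedWeight, Set.indicator_of_mem (s := {x | τ k x = N}) hx, Pi.one_apply, mul_one,
      norm_prod]
    refine (Finset.prod_le_prod (fun i _ => norm_nonneg _)
      (g := fun _ => ∑ m ∈ Finset.range (N + 1), φ m) fun i hi => ?_).trans_eq (by simp)
    rw [Real.norm_of_nonneg (hφ _)]
    refine Finset.single_le_sum (f := φ) (fun m _ => hφ m) (Finset.mem_range.2 ?_)
    have : τ (i + 1) x ≤ τ k x :=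
      (hτ.strictMono x).monotone (Nat.succ_le_of_lt (Finset.mem_range.1 hi))
    omega
  · rw [indexedWeight, Set.indicator_of_notMem (s := {x | τ k x = N}) hx, mul_zero, norm_zero]
    positivity

lemma IsRenewal.indexedWeight_succ (hτ : IsRenewal P τ) (φ : ℕ → ℝ) (k N : ℕ) (x : S) :
    indexedWeight τ φ (k + 1) N x = ∑ n ∈ Finset.range N, φ N *
      (indexedWeight τ φ k n x * Set.indicator {m | m = N - n} 1 (τ (k + 1) x - τ k x)) := by
  have hlt := hτ.lt_succ k x
  by_cases hx : τ (k + 1) x = N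
  · rw [Finset.sum_eq_single (τ k x)]
    · simp [indexedWeight, Finset.prod_range_succ, hx]
      ring
    · intro n _ hn
      simp [indexedWeight, Set.indicator, hn.symm]
    · intro h
      exact absurd (Finset.mem_range.2 (hx ▸ hlt)) h
  · rw [Finset.sum_eq_zero]
    · simp [indexedWeight, hx]
    · intro n hn
      have hn' := Finset.mem_range.1 hn
      by_cases h1 : τ k x = n
      · have : ¬ (τ (k + 1) x - τ k x = N - n) := by omega
        simp [Set.indicator, this]
      · simp [indexedWeight, Set.indicator, h1]

/-- The weight of the first `k` renewals depends on the first `k` gaps only, hence is independent of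
the next gap, whose law is `K`. -/
lemma IsRenewal.integral_indexedWeight_succ [IsFiniteMeasure P] (hτ : IsRenewal P τ) {φ : ℕ → ℝ}
    (hφ : ∀ n, 0 ≤ φ n)
    (k N : ℕ) : ∫ x, indexedWeight τ φ (k + 1) N x ∂P = φ N * ∑ n ∈ Finset.range N,
      (∫ x, indexedWeight τ φ k n x ∂P) * interArrival P τ (N - n) := by
  have hind : ∀ n, Measurable fun x =>
      Set.indicator {m : ℕ | m = N - n} (1 : ℕ → ℝ) (τ (k + 1) x - τ k x) := fun n =>
    (measurable_from_top (f := Set.indicator {m : ℕ | m = N - n} (1 : ℕ → ℝ))).comp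
      (hτ.measurable_gap k)
  simp_rw [hτ.indexedWeight_succ]
  rw [integral_finsetSum, Finset.mul_sum]
  · refine Finset.sum_congr rfl fun n _ => ?_
    rw [integral_const_mul]
    congr 1
    have hI : IndepFun (indexedWeight τ φ k n) (fun x =>
        Set.indicator {m : ℕ | m = N - n} (1 : ℕ → ℝ) (τ (k + 1) x - τ k x)) P := by
      refine indepFun_of_measurable_iSup hτ.measurable_gap hτ.indep (s := Set.Iio k) (t := {k})
        (by simp) (hτ.measurable_indexedWeight φ k n) ?_
      exact (measurable_from_top (f := Set.indicator {m : ℕ | m = N - n} (1 : ℕ → ℝ))).comp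
        (measurable_coordinate (fun i x => τ (i + 1) x - τ i x) (Set.mem_singleton k))
    rw [hI.integral_fun_mul_eq_mul_integral
      (hτ.integrable_indexedWeight hφ k n).aestronglyMeasurable (hind n).aestronglyMeasurable]
    congr 1
    have hid := (hτ.ident k).comp
      (measurable_from_top (f := Set.indicator {m : ℕ | m = N - n} (1 : ℕ → ℝ)))
    have := hid.integral_eq
    simp only [Function.comp_def] at this
    rw [this, interArrival, ← integral_indicator_one
      (show MeasurableSet {x | τ 1 x = N - n} from
        (hτ.measurable 1) (measurableSet_singleton _))]
    refine integral_congr_ae (Eventually.of_forall fun x => ?_)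
    simp [Set.indicator, hτ.zero]
  · intro n _
    refine ((hτ.integrable_indexedWeight hφ k n).mul_bdd (c := 1)
      (hind n).aestronglyMeasurable (Eventually.of_forall fun x => ?_)).const_mul _
    simp only [Set.indicator]
    split_ifs <;> simp

lemma IsRenewal.integral_indexedWeight_eq_zero (hτ : IsRenewal P τ) (φ : ℕ → ℝ) {k N : ℕ}
    (h : N < k) : ∫ x, indexedWeight τ φ k N x ∂P = 0 := by
  have : indexedWeight τ φ k N = fun _ => 0 := by
    funext x
    have := (hτ.strictMono x).id_le k
    simp only [id] at this
    have hne : τ k x ≠ N := by omega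
    simp [indexedWeight, hne]
  simp [this]

lemma IsRenewal.sum_integral_indexedWeight [IsProbabilityMeasure P] (hτ : IsRenewal P τ)
    {φ : ℕ → ℝ} (hφ : ∀ n, 0 ≤ φ n)
    (N : ℕ) : ∑ k ∈ Finset.range (N + 1), ∫ x, indexedWeight τ φ k N x ∂P =
      pinSum (interArrival P τ) (fun i => φ (i + 1)) N := by
  induction N using Nat.strong_induction_on with
  | _ N ih =>
    cases N with
    | zero => simp [indexedWeight, hτ.zero]
    | succ N =>
      rw [Finset.sum_range_succ', pinSum_succ]
      have h0 : ∫ x, indexedWeight τ φ 0 (N + 1) x ∂P = 0 := by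
        simp [indexedWeight, hτ.zero]
      simp_rw [h0, hτ.integral_indexedWeight_succ hφ]
      rw [← Finset.mul_sum, Finset.sum_comm, add_zero]
      congr 1
      refine Finset.sum_congr rfl fun n hn => ?_
      have hn' := Finset.mem_range.1 hn
      rw [← Finset.sum_mul, ← ih n hn']
      congr 1
      symm
      -- Extending the range of `k` beyond `n` is harmless, because `τ k ≥ k`.
      refine Finset.sum_subset (Finset.range_mono (by omega)) fun k _ hk => ?_
      exact hτ.integral_indexedWeight_eq_zero φ (by simpa using hk)

/-- By strict monotonicity at most one index `k` has `τ k = N`, and then the contacts in `1, …, N`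
are exactly `τ 1, …, τ k`. -/
lemma IsRenewal.sum_indexedWeight (hτ : IsRenewal P τ) (c : ℕ → ℝ) (N : ℕ) (x : S) :
    Real.exp (∑ n ∈ Finset.Icc 1 N, c n * contact τ n x) * contact τ N x =
      ∑ k ∈ Finset.range (N + 1), indexedWeight τ (fun n => Real.exp (c n)) k N x := by
  have hsm := hτ.strictMono x
  by_cases hN : ∃ k, τ k x = N
  · obtain ⟨k, hk⟩ := hN
    have hkN : k ≤ N := by
      have := hsm.id_le k
      simp only [id] at this; omega
    refine Eq.trans ?_ (Finset.sum_eq_single k ?_ ?_).symm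
    · have h1 : contact τ N x = 1 := contact_of_exists ⟨k, hk⟩
      have h2 : ∑ n ∈ Finset.Icc 1 N, c n * contact τ n x =
          ∑ i ∈ Finset.range k, c (τ (i + 1) x) := by
        rw [← Finset.sum_image (f := c) (g := fun i => τ (i + 1) x) (s := Finset.range k)
          (fun i _ j _ hij => by simpa using hsm.injective hij)]
        symm
        have hsub : Finset.image (fun i => τ (i + 1) x) (Finset.range k) ⊆ Finset.Icc 1 N := by
          intro n hn
          obtain ⟨i, hi, rfl⟩ := Finset.mem_image.1 hn
          have h3 := hsm (Nat.succ_pos i)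
          have h4 := hsm.monotone (Nat.succ_le_of_lt (Finset.mem_range.1 hi))
          simp only [Nat.succ_eq_add_one] at h3 h4
          rw [Finset.mem_Icc]; omega
        rw [← Finset.sum_subset hsub]
        · refine Finset.sum_congr rfl fun n hn => ?_
          obtain ⟨i, hi, rfl⟩ := Finset.mem_image.1 hn
          rw [contact_of_exists ⟨i + 1, rfl⟩, mul_one]
        · intro n hn hn'
          rw [contact_of_not_exists, mul_zero]
          rintro ⟨j, hj⟩
          obtain ⟨hn1, hn2⟩ := Finset.mem_Icc.1 hn
          apply hn'
          cases j with
          | zero => rw [hτ.zero] at hj; omega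
          | succ j =>
            refine Finset.mem_image.2 ⟨j, Finset.mem_range.2 ?_, hj⟩
            have : τ (j + 1) x ≤ τ k x := by omega
            exact hsm.le_iff_le.1 this
      rw [h1, h2, Real.exp_sum]
      simp [indexedWeight, hk]
    · intro j _ hj
      have : τ j x ≠ N := fun h => hj (hsm.injective (h.trans hk.symm))
      simp [indexedWeight, this]
    · intro h
      exact absurd (Finset.mem_range.2 (by omega)) h
  · have h1 : contact τ N x = 0 := contact_of_not_exists hN
    rw [h1, mul_zero, Finset.sum_eq_zero]
    intro k _
    have : τ k x ≠ N := fun h => hN ⟨k, h⟩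
    simp [indexedWeight, this]

/-- The partition function solves the renewal recursion. -/
theorem IsRenewal.partitionFunction_eq [IsProbabilityMeasure P] (hτ : IsRenewal P τ) (β h : ℝ)
    (w : ℕ → ℝ) (N : ℕ) :
    partitionFunction P τ β h w N =
      pinSum (interArrival P τ) (fun i => Real.exp (β * w (i + 1) + h)) N := by
  rw [partitionFunction]
  simp_rw [hτ.sum_indexedWeight (fun n => β * w n + h) N]
  rw [integral_finsetSum _ fun k _ =>
    hτ.integrable_indexedWeight (fun n => (Real.exp_pos _).le) k N]
  exact hτ.sum_integral_indexedWeight (fun n => (Real.exp_pos _).le) N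

lemma IsRenewal.sum_interArrival_le [IsProbabilityMeasure P] (hτ : IsRenewal P τ) (s : Finset ℕ) :
    ∑ n ∈ s, interArrival P τ n ≤ 1 := by
  have := sum_measureReal_preimage_singleton (μ := P) (f := τ 1) s
    (fun y _ => (hτ.measurable 1) (measurableSet_singleton y))
  simp only [interArrival]
  exact this.trans_le measureReal_le_one

end Renewal

/-! ### IID weights and measurability of the partition sums. -/

/-- IID positive site weights with finite mean and integrable logarithm. -/
structure IIDWeights {Ω : Type*} [MeasurableSpace Ω] (μ : Measure Ω) (Y : ℕ → Ω → ℝ) : Prop where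
  measurable : ∀ i, Measurable (Y i)
  indep : iIndepFun Y μ
  ident : ∀ i, IdentDistrib (Y i) (Y 0) μ μ
  pos : ∀ i a, 0 < Y i a
  integrable : Integrable (Y 0) μ
  integrable_log : Integrable (fun a => Real.log (Y 0 a)) μ

lemma measurable_pinSum {Ω : Type*} [MeasurableSpace Ω] (K : ℕ → ℝ) {Y : ℕ → Ω → ℝ} {d : ℕ}
    (h : ∀ i < d, Measurable (Y i)) : Measurable fun a => pinSum K (fun i => Y i a) d := by
  induction d using Nat.strong_induction_on with
  | _ d ih =>
    cases d with
    | zero => simp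
    | succ d =>
      simp_rw [pinSum_succ]
      refine (h d (Nat.lt_succ_self d)).mul (Finset.measurable_fun_sum _ fun k hk => ?_)
      have hk' := Finset.mem_range.1 hk
      exact (ih k hk' fun i hi => h i (hi.trans hk')).mul_const _

lemma measurable_occSum {Ω : Type*} [MeasurableSpace Ω] (K : ℕ → ℝ) {Y : ℕ → Ω → ℝ} {d : ℕ}
    (h : ∀ i ≤ d, Measurable (Y i)) : Measurable fun a => occSum K (fun i => Y i a) d := by
  induction d using Nat.strong_induction_on with
  | _ d ih =>
    simp_rw [fun a => occSum_eq K (fun i => Y i a) d]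
    refine (h d le_rfl).mul (Measurable.const_add (Finset.measurable_fun_sum _ fun k hk => ?_) 1)
    have hk' := Finset.mem_range.1 hk
    exact (ih k hk' fun i hi => h i (hi.trans hk'.le)).mul_const _

lemma measurable_freeSum {Ω : Type*} [MeasurableSpace Ω] (K : ℕ → ℝ) {Y : ℕ → Ω → ℝ} {n : ℕ}
    (h : ∀ i < n, Measurable (Y i)) : Measurable fun a => freeSum K (fun i => Y i a) n := by
  simp only [freeSum]
  exact Measurable.const_add (Finset.measurable_fun_sum _ fun k hk =>
    measurable_occSum K fun i hi => h i (hi.trans_lt (Finset.mem_range.1 hk))) 1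

lemma measurable_log_pinSum {Ω : Type*} [MeasurableSpace Ω] (K : ℕ → ℝ) {Y : ℕ → Ω → ℝ} {d : ℕ}
    (h : ∀ i < d, Measurable (Y i)) :
    Measurable fun a => Real.log (pinSum K (fun i => Y i a) d) :=
  Real.measurable_log.comp (measurable_pinSum K h)

lemma measurable_log_freeSum {Ω : Type*} [MeasurableSpace Ω] (K : ℕ → ℝ) {Y : ℕ → Ω → ℝ} {n : ℕ}
    (h : ∀ i < n, Measurable (Y i)) :
    Measurable fun a => Real.log (freeSum K (fun i => Y i a) n) :=
  Real.measurable_log.comp (measurable_freeSum K h)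

/-! ### Block estimates for logarithms and averages. -/

section Blocks

variable {K y : ℕ → ℝ}

lemma pinSum_pos (hK : ∀ n, 0 ≤ K n) (hy : ∀ n, 0 < y n) {d : ℕ} (hd : 1 ≤ d) (h : 0 < K d) :
    0 < pinSum K y d := by
  obtain ⟨d, rfl⟩ := Nat.exists_eq_add_of_le' hd
  exact (mul_pos (hy d) h).trans_le (single_jump_le_pinSum hK (fun n => (hy n).le) d)

lemma le_log_pinSum (hK : ∀ n, 0 ≤ K n) (hy : ∀ n, 0 < y n) {d : ℕ} (hd : 1 ≤ d) (h : 0 < K d) :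
    Real.log (y (d - 1)) + Real.log (K d) ≤ Real.log (pinSum K y d) := by
  obtain ⟨d, rfl⟩ := Nat.exists_eq_add_of_le' hd
  rw [Nat.add_sub_cancel, ← Real.log_mul (hy d).ne' h.ne']
  exact Real.log_le_log (mul_pos (hy d) h) (single_jump_le_pinSum hK (fun n => (hy n).le) d)

lemma log_freeSum_mul_le (hK : ∀ n, 0 ≤ K n) (hK1 : ∀ n, K n ≤ 1) (hy : ∀ n, 0 ≤ y n) (m J : ℕ) :
    Real.log (freeSum K y (J * m)) ≤
      ∑ i ∈ Finset.range J, Real.log (freeSum K (shiftSeq (i * m) y) m) := by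
  induction J with
  | zero => simp [freeSum]
  | succ J ih =>
    have h1 := one_le_freeSum hK hy (J * m)
    have h2 := one_le_freeSum hK (y := shiftSeq (J * m) y) (fun _ => hy _) m
    rw [Finset.sum_range_succ, Nat.succ_mul]
    refine le_trans ?_ (add_le_add ih le_rfl)
    rw [← Real.log_mul (by linarith) (by linarith)]
    exact Real.log_le_log (by linarith [one_le_freeSum hK hy (J * m + m)])
      (freeSum_add_le hK hK1 hy _ _)

/-- Contacts are forced at the ends of `J` blocks of length `m`, and the remainder `r` is covered by
a single jump. -/
lemma sum_log_pinSum_le (hK : ∀ n, 0 ≤ K n) (hy : ∀ n, 0 < y n) {m r : ℕ} (hm : 1 ≤ m)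
    (hKm : 0 < K m) (hr : 1 ≤ r) (hKr : 0 < K r) (J : ℕ) :
    ∑ i ∈ Finset.range J, Real.log (pinSum K (shiftSeq (i * m) y) m) +
      (Real.log (y (J * m + r - 1)) + Real.log (K r)) ≤ Real.log (pinSum K y (J * m + r)) := by
  have hs : ∀ l, ∀ n, 0 < shiftSeq l y n := fun l n => hy _
  have key : ∀ J, 0 < pinSum K y (J * m) ∧
      ∑ i ∈ Finset.range J, Real.log (pinSum K (shiftSeq (i * m) y) m) ≤
        Real.log (pinSum K y (J * m)) := by
    intro J
    induction J with
    | zero => simp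
    | succ J ih =>
      have h1 := pinSum_mul_le hK (fun n => (hy n).le) (J * m) m
      have h2 := pinSum_pos hK (hs (J * m)) hm hKm
      rw [Finset.sum_range_succ, Nat.succ_mul]
      refine ⟨(mul_pos ih.1 h2).trans_le h1, (add_le_add ih.2 le_rfl).trans ?_⟩
      rw [← Real.log_mul ih.1.ne' h2.ne']
      exact Real.log_le_log (mul_pos ih.1 h2) h1
  have h2 := pinSum_pos hK (hs (J * m)) hr hKr
  have h3 := le_log_pinSum hK (hs (J * m)) hr hKr
  rw [shiftSeq_apply, ← Nat.add_sub_assoc hr] at h3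
  refine (add_le_add (key J).2 h3).trans ?_
  rw [← Real.log_mul (key J).1.ne' h2.ne']
  exact Real.log_le_log (mul_pos (key J).1 h2) (pinSum_mul_le hK (fun n => (hy n).le) _ _)

/-- Each term is a difference of two consecutive partial sums. This discards the weight of the last
site in the lower bound. -/
lemma tendsto_div_of_tendsto_average {x : ℕ → ℝ} {c : ℝ}
    (h : Tendsto (fun n : ℕ => (∑ i ∈ Finset.range n, x i) / n) atTop (𝓝 c)) :
    Tendsto (fun n : ℕ => x n / (n + 1 : ℕ)) atTop (𝓝 0) := by
  have h1 := (tendsto_add_atTop_iff_nat 1).2 h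
  have h2 := h.mul (tendsto_natCast_div_add_atTop (1 : ℝ))
  have h3 := h1.sub h2
  rw [mul_one, sub_self] at h3
  refine h3.congr' ?_
  filter_upwards [eventually_ge_atTop 1] with n hn
  have : (n : ℝ) ≠ 0 := by positivity
  have : (n : ℝ) + 1 ≠ 0 := by positivity
  rw [Finset.sum_range_succ]
  push_cast
  field_simp
  ring

lemma tendsto_natDiv_add_div {m : ℕ} (hm : 1 ≤ m) (e : ℤ) :
    Tendsto (fun N : ℕ => (((N / m : ℕ) : ℝ) + e) / N) atTop (𝓝 (1 / m)) := by
  have hm0 : (m : ℝ) ≠ 0 := by positivity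
  have h1 := (tendsto_nat_floor_mul_div_atTop (R := ℝ) (a := 1 / m) (by positivity)).comp
    tendsto_natCast_atTop_atTop
  have h2 : Tendsto (fun N : ℕ => (e : ℝ) / N) atTop
      (𝓝 0) := tendsto_const_div_atTop_nhds_zero_nat _
  have h3 := h1.add h2
  rw [add_zero] at h3
  refine h3.congr fun N => ?_
  simp only [Function.comp_apply]
  rw [add_div, one_div_mul_eq_div, Nat.floor_div_eq_div]

end Blocks

/-! ### Existence of the free energy. -/

section FreeEnergy

variable {Ω : Type*} [MeasurableSpace Ω] {μ : Measure Ω} {K : ℕ → ℝ}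
  {Y : ℕ → Ω → ℝ}

lemma IIDWeights.identDistrib_shift (hY : IIDWeights μ Y) (l : ℕ) :
    IdentDistrib (fun a => shiftSeq l (fun i => Y i a)) (fun a i => Y i a) μ μ :=
  IdentDistrib.pi (fun i => (hY.ident (l + i)).trans (hY.ident i).symm)
    (hY.indep.precomp (add_right_injective l)) hY.indep

/-- The law of large numbers along consecutive blocks of length `m`. -/
lemma IIDWeights.tendsto_average_blocks (hY : IIDWeights μ Y) {Φ : (ℕ → ℝ) → ℝ} (m : ℕ)
    (hΦ : Measurable Φ)
    (hloc : ∀ l, Measurable[⨆ i ∈ Set.Ico l (l + m), (inferInstance : MeasurableSpace ℝ).comap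
        (Y i)]
      fun a => Φ (shiftSeq l fun i => Y i a))
    (hint : Integrable (fun a => Φ fun i => Y i a) μ) :
    ∀ᵐ a ∂μ, Tendsto (fun J : ℕ =>
      (∑ i ∈ Finset.range J, Φ (shiftSeq (i * m) fun i => Y i a)) / J) atTop
      (𝓝 (∫ a, Φ (fun i => Y i a) ∂μ)) := by
  have hid : ∀ i, IdentDistrib (fun a => Φ (shiftSeq (i * m) fun i => Y i a))
      (fun a => Φ (fun i => Y i a)) μ μ := fun i => (hY.identDistrib_shift (i * m)).comp hΦ
  have h0 : (fun a => Φ (shiftSeq (0 * m) fun i => Y i a)) = fun a => Φ (fun i => Y i a) := by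
    funext a; simp
  have := strong_law_ae_real (μ := μ) (fun i a => Φ (shiftSeq (i * m) fun i => Y i a))
    (by simpa using hint) ?_ (fun i => by rw [h0]; exact hid i)
  · simpa using this
  · intro i j hij
    refine indepFun_of_measurable_iSup hY.measurable hY.indep ?_ (hloc _) (hloc _)
    rw [Set.disjoint_left]
    intro n hi hj
    simp only [Set.mem_Ico] at hi hj
    apply hij
    have h1 : i * m < (j + 1) * m := by rw [Nat.succ_mul]; omega
    have h2 : j * m < (i + 1) * m := by rw [Nat.succ_mul]; omega
    have h3 := lt_of_mul_lt_mul_right h1 (Nat.zero_le m)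
    have h4 := lt_of_mul_lt_mul_right h2 (Nat.zero_le m)
    omega

lemma IIDWeights.integrable_log_freeSum (hY : IIDWeights μ Y) (hK : ∀ n, 0 ≤ K n)
    (hK1 : ∀ n, K n ≤ 1) (m : ℕ) :
    Integrable (fun a => Real.log (freeSum K (fun i => Y i a) m)) μ := by
  refine Integrable.mono' (g := fun a => ∑ i ∈ Finset.range m, Y i a)
    (integrable_finsetSum _ fun i _ => (hY.ident i).integrable_iff.2 hY.integrable)
    (measurable_log_freeSum K fun i _ => hY.measurable i).aestronglyMeasurable
    (Eventually.of_forall fun a => ?_)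
  have hpos : ∀ i, 0 ≤ Y i a := fun i => (hY.pos i a).le
  rw [Real.norm_of_nonneg (Real.log_nonneg (one_le_freeSum hK hpos m))]
  exact log_freeSum_le hK hK1 hpos m

lemma IIDWeights.integrable_log_apply (hY : IIDWeights μ Y) (i : ℕ) :
    Integrable (fun a => Real.log (Y i a)) μ :=
  ((hY.ident i).comp Real.measurable_log).integrable_iff.2 hY.integrable_log

lemma IIDWeights.integral_log_apply (hY : IIDWeights μ Y) (i : ℕ) :
    ∫ a, Real.log (Y i a) ∂μ = ∫ a, Real.log (Y 0 a) ∂μ :=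
  ((hY.ident i).comp Real.measurable_log).integral_eq

lemma IIDWeights.integrable_log_pinSum [IsFiniteMeasure μ] (hY : IIDWeights μ Y) (hK : ∀ n, 0 ≤ K n)
    (hK1 : ∀ n, K n ≤ 1) {m : ℕ} (hm : 1 ≤ m) (hKm : 0 < K m) :
    Integrable (fun a => Real.log (pinSum K (fun i => Y i a) m)) μ := by
  refine integrable_of_le_of_le (measurable_log_pinSum K
      fun i _ => hY.measurable i).aestronglyMeasurable
    (Eventually.of_forall fun a => le_log_pinSum hK (fun i => hY.pos i a) hm hKm)
    (Eventually.of_forall fun a => Real.log_le_log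
      (pinSum_pos hK (fun i => hY.pos i a) hm hKm)
      (pinSum_le_freeSum hK hK1 (fun i => (hY.pos i a).le) m))
    ((hY.integrable_log_apply _).add (integrable_const _)) (hY.integrable_log_freeSum hK hK1 m)

/-- The segment is covered by `N / m + 1` blocks, submultiplicativity is applied, and the law of
large numbers averages the independent block terms. -/
lemma IIDWeights.ae_tendsto_upper (hY : IIDWeights μ Y) (hK : ∀ n, 0 ≤ K n) (hK1 : ∀ n, K n ≤ 1)
    {m : ℕ} (hm : 1 ≤ m) :
    ∀ᵐ a ∂μ, ∃ U : ℕ → ℝ,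
      Tendsto U atTop (𝓝 ((∫ a, Real.log (freeSum K (fun i => Y i a) m) ∂μ) / m)) ∧
      ∀ N, 0 < pinSum K (fun i => Y i a) N →
        1 / (N : ℝ) * Real.log (pinSum K (fun i => Y i a) N) ≤ U N := by
  have h := hY.tendsto_average_blocks (Φ := fun y => Real.log (freeSum K y m)) m
    (measurable_log_freeSum K fun i _ => measurable_pi_apply i)
    (fun l => @measurable_log_freeSum Ω (_) K (fun i => Y (l + i)) m fun i hi =>
      measurable_coordinate Y (Set.mem_Ico.2 ⟨Nat.le_add_right l i, by omega⟩))
    (hY.integrable_log_freeSum hK hK1 m)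
  filter_upwards [h] with a ha
  have hpos : ∀ i, 0 ≤ Y i a := fun i => (hY.pos i a).le
  refine ⟨fun N => ((∑ i ∈ Finset.range (N / m + 1),
    Real.log (freeSum K (shiftSeq (i * m) fun i => Y i a) m)) / (N / m + 1 : ℕ)) *
      ((((N / m : ℕ) : ℝ) + (1 : ℤ)) / N), ?_, ?_⟩
  · have h1 : Tendsto (fun N : ℕ => N / m + 1) atTop atTop :=
      tendsto_atTop_mono (fun N => Nat.le_succ _) (Nat.tendsto_div_const_atTop (by omega))
    have h2 := (ha.comp h1).mul (tendsto_natDiv_add_div hm 1)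
    rw [mul_one_div] at h2
    exact h2
  · intro N hN
    have h0 : (0 : ℝ) < ((N / m + 1 : ℕ) : ℝ) := by positivity
    have h1 : N ≤ (N / m + 1) * m := by
      have := Nat.div_add_mod N m
      have := Nat.mod_lt N (show 0 < m by omega)
      rw [Nat.succ_mul, mul_comm]; omega
    have h2 : Real.log (pinSum K (fun i => Y i a) N) ≤ ∑ i ∈ Finset.range (N / m + 1),
        Real.log (freeSum K (shiftSeq (i * m) fun i => Y i a) m) :=
      (Real.log_le_log hN ((pinSum_le_freeSum hK hK1 hpos N).trans (freeSum_mono hK hpos h1))).trans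
        (log_freeSum_mul_le hK hK1 hpos m _)
    have h3 : (((N / m : ℕ) : ℝ) + ((1 : ℤ) : ℝ)) = ((N / m + 1 : ℕ) : ℝ) := by push_cast; rfl
    beta_reduce
    rw [h3, div_mul_div_cancel₀ h0.ne', one_div_mul_eq_div]
    exact div_le_div_of_nonneg_right h2 (Nat.cast_nonneg N)

/-- Using `N / m - 1` blocks leaves a remainder of length between `m` and `2 * m`, where the single
jump costs at least `κ`, uniformly in `N`. -/
lemma IIDWeights.ae_tendsto_lower [IsFiniteMeasure μ] (hY : IIDWeights μ Y) (hK : ∀ n, 0 ≤ K n)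
    (hK1 : ∀ n, K n ≤ 1)
    {m : ℕ} (hm : 1 ≤ m) {κ : ℝ} (hκ : 0 < κ) (hKpos : ∀ q, m ≤ q → 0 < K q)
    (hKκ : ∀ q, m ≤ q → q ≤ 2 * m → κ ≤ K q) :
    ∀ᵐ a ∂μ, ∃ L : ℕ → ℝ,
      Tendsto L atTop (𝓝 ((∫ a, Real.log (pinSum K (fun i => Y i a) m) ∂μ) / m)) ∧
      ∀ N, m ≤ N → 0 < pinSum K (fun i => Y i a) N ∧
        (2 * m ≤ N → L N ≤ 1 / (N : ℝ) * Real.log (pinSum K (fun i => Y i a) N)) := by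
  have h := hY.tendsto_average_blocks (Φ := fun y => Real.log (pinSum K y m)) m
    (measurable_log_pinSum K fun i _ => measurable_pi_apply i)
    (fun l => @measurable_log_pinSum Ω (_) K (fun i => Y (l + i)) m fun i hi =>
      measurable_coordinate Y (Set.mem_Ico.2 ⟨Nat.le_add_right l i, by omega⟩))
    (hY.integrable_log_pinSum hK hK1 hm (hKpos m le_rfl))
  have h' := strong_law_ae_real (μ := μ) (fun i a => Real.log (Y i a)) hY.integrable_log
    (fun i j hij => (hY.indep.indepFun hij).comp Real.measurable_log Real.measurable_log)
    (fun i => (hY.ident i).comp Real.measurable_log)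
  filter_upwards [h, h'] with a ha ha'
  have hpos : ∀ i, 0 < Y i a := fun i => hY.pos i a
  have hlog : Tendsto (fun N : ℕ => Real.log (Y (N - 1) a) / N) atTop (𝓝 0) :=
    (tendsto_add_atTop_iff_nat 1).1 (tendsto_div_of_tendsto_average ha')
  refine ⟨fun N => ((∑ i ∈ Finset.range (N / m - 1),
    Real.log (pinSum K (shiftSeq (i * m) fun i => Y i a) m)) / (N / m - 1 : ℕ)) *
      ((((N / m : ℕ) : ℝ) + (-1 : ℤ)) / N) + (Real.log (Y (N - 1) a) / N + Real.log κ / N), ?_, ?_⟩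
  · have h1 : Tendsto (fun N : ℕ => N / m - 1) atTop atTop :=
      (tendsto_sub_atTop_nat 1).comp (Nat.tendsto_div_const_atTop (by omega))
    have h2 := ((ha.comp h1).mul (tendsto_natDiv_add_div hm (-1))).add
      (hlog.add (tendsto_const_div_atTop_nhds_zero_nat (Real.log κ)))
    rw [mul_one_div, add_zero, add_zero] at h2
    exact h2
  · intro N hN
    refine ⟨pinSum_pos hK hpos (hm.trans hN) (hKpos N hN), fun hN2 => ?_⟩
    obtain ⟨J, hJ⟩ : ∃ J, N / m = J + 1 :=
      ⟨N / m - 1, by have := Nat.div_pos hN (by omega : 0 < m); omega⟩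
    have hJ0 : J ≠ 0 := by
      rintro rfl
      have := (Nat.le_div_iff_mul_le (by omega : 0 < m)).2 hN2
      omega
    obtain ⟨r, hr, hrm, hr2⟩ : ∃ r, N = J * m + r ∧ m ≤ r ∧ r ≤ 2 * m := by
      have h1 := Nat.div_add_mod N m
      have h2 := Nat.mod_lt N (show 0 < m by omega)
      rw [hJ, mul_comm, Nat.succ_mul] at h1
      exact ⟨m + N % m, by omega, by omega, by omega⟩
    have h3 := sum_log_pinSum_le hK hpos hm (hKpos m le_rfl) (hm.trans hrm) (hKpos r hrm) J
    rw [← hr] at h3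
    have h4 := Real.log_le_log hκ (hKκ r hrm hr2)
    have h5 : (((N / m : ℕ) : ℝ) + ((-1 : ℤ) : ℝ)) = J := by rw [hJ]; push_cast; ring
    beta_reduce
    rw [h5, hJ, Nat.add_sub_cancel, div_mul_div_cancel₀ (by exact_mod_cast hJ0), ← add_div,
      ← add_div, one_div_mul_eq_div]
    exact div_le_div_of_nonneg_right (by linarith) (Nat.cast_nonneg N)

/-- Existence of the free energy, with a lower bound from the one-jump strategy. -/
theorem IIDWeights.exists_freeEnergy [IsProbabilityMeasure μ] (hY : IIDWeights μ Y)
    (hK : ∀ n, 0 ≤ K n) (hK1 : ∀ n, K n ≤ 1) {p : ℕ} (hp : 1 ≤ p) {κ : ℕ → ℝ}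
    (hκ0 : ∀ m, 0 < κ m) (hκ1 : ∀ m, κ m ≤ 1) (hκ : ∀ m q, p ≤ q → q ≤ m → κ m ≤ K q)
    (hκlim : Tendsto (fun m : ℕ => Real.log (κ m) / m) atTop (𝓝 0)) :
    ∃ f : ℝ, (∀ᵐ a ∂μ, Tendsto
        (fun N : ℕ => 1 / (N : ℝ) * Real.log (pinSum K (fun i => Y i a) N)) atTop (𝓝 f)) ∧
      ∀ m ≥ p, ∫ a, Real.log (Y 0 a) ∂μ + Real.log (K m) ≤ m * f := by
  set g : ℕ → ℝ := fun m => ∫ a, Real.log (freeSum K (fun i => Y i a) m) ∂μ with hg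
  set e : ℕ → ℝ := fun m => ∫ a, Real.log (pinSum K (fun i => Y i a) m) ∂μ with he
  have hYp : ∀ a i, 0 < Y i a := fun a i => hY.pos i a
  have hKpos : ∀ q, p ≤ q → 0 < K q := fun q hq => (hκ0 q).trans_le (hκ q q hq le_rfl)
  have hg0 : ∀ m, 0 ≤ g m := fun m => integral_nonneg fun a =>
    Real.log_nonneg (one_le_freeSum hK (fun i => (hYp a i).le) m)
  -- The limit is the infimum of the expected free averages, which dominate the upper growth rate;
  -- the index starts at one to avoid division by zero.
  set f : ℝ := ⨅ m : ℕ, g (m + 1) / (m + 1 : ℕ) with hf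
  have hbdd : BddBelow (Set.range fun m : ℕ => g (m + 1) / (m + 1 : ℕ)) :=
    ⟨0, by rintro _ ⟨m, rfl⟩; exact div_nonneg (hg0 _) (Nat.cast_nonneg _)⟩
  have hfg : ∀ m, m * f ≤ g m := by
    intro m
    cases m with
    | zero => simpa using hg0 0
    | succ m =>
      have := ciInf_le hbdd m
      rw [mul_comm, ← le_div_iff₀ (by positivity)]
      exact this
  -- Expected logarithms in `freeSum_le_pinSum`: the correction, made of `log (κ M)`, `log M` and
  -- one site weight, is `o(M)`.
  have hcomp : ∀ M : ℕ, 2 * p ≤ M → (M - 2 * p) * f + (2 * Real.log (κ M) +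
      ∫ a, Real.log (Y 0 a) ∂μ - Real.log M) ≤ e M := by
    intro M hM
    obtain ⟨m, rfl⟩ := Nat.exists_eq_add_of_le' hM
    have hM0 : (0 : ℝ) < ((m + 2 * p : ℕ) : ℝ) := by exact_mod_cast (by omega : 0 < m + 2 * p)
    have hid : IdentDistrib (fun a => Real.log (freeSum K (shiftSeq p fun i => Y i a) m))
        (fun a => Real.log (freeSum K (fun i => Y i a) m)) μ μ :=
      (hY.identDistrib_shift p).comp (measurable_log_freeSum K fun i _ => measurable_pi_apply i)
    have hi1 := hid.integrable_iff.2 (hY.integrable_log_freeSum hK hK1 m)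
    have hpt : ∀ a, Real.log (freeSum K (shiftSeq p fun i => Y i a) m) +
        (Real.log (Y (m + 2 * p - 1) a) + (2 * Real.log (κ (m + 2 * p)) -
          Real.log (m + 2 * p : ℕ))) ≤ Real.log (pinSum K (fun i => Y i a) (m + 2 * p)) := by
      intro a
      have h1 := freeSum_le_pinSum hK (fun i => (hYp a i).le) (hκ0 (m + 2 * p)).le (hκ1 _) hp
        (hκ (m + 2 * p))
      have hG := one_le_freeSum hK (y := shiftSeq p fun i => Y i a) (fun i => (hYp a _).le) m
      have hP := pinSum_pos hK (hYp a) (by omega) (hKpos (m + 2 * p) (by omega))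
      have h2 : ((1 : ℝ) + m) * pinSum K (fun i => Y i a) (m + 2 * p) ≤
          ((m + 2 * p : ℕ) : ℝ) * pinSum K (fun i => Y i a) (m + 2 * p) := by
        refine mul_le_mul_of_nonneg_right ?_ hP.le
        exact_mod_cast (by omega : 1 + m ≤ m + 2 * p)
      have hκsq : 0 < κ (m + 2 * p) ^ 2 := pow_pos (hκ0 _) 2
      have h3 := Real.log_le_log (mul_pos (mul_pos hκsq (hYp a _)) (by linarith)) (h1.trans h2)
      rw [Real.log_mul (mul_pos hκsq (hYp a _)).ne' (by linarith),
        Real.log_mul hκsq.ne' (hYp a _).ne', Real.log_mul hM0.ne' hP.ne', Real.log_pow] at h3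
      push_cast at h3 ⊢
      linarith
    have hi2 : Integrable (fun a => Real.log (Y (m + 2 * p - 1) a) +
        (2 * Real.log (κ (m + 2 * p)) - Real.log (m + 2 * p : ℕ))) μ :=
      (hY.integrable_log_apply _).add (integrable_const _)
    have hint := integral_mono (hi1.add hi2)
      (hY.integrable_log_pinSum hK hK1 (by omega) (hKpos (m + 2 * p) (by omega))) hpt
    simp only [Pi.add_apply] at hint
    rw [integral_add hi1 hi2,
      integral_add (hY.integrable_log_apply _) (integrable_const _), hid.integral_eq,
      hY.integral_log_apply] at hint
    simp only [integral_const, probReal_univ, one_smul] at hint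
    have h5 := hfg m
    refine le_trans ?_ hint
    push_cast
    simp only [hg] at h5
    linarith
  have hupper : ∀ᵐ a ∂μ, ∀ m : ℕ, ∃ U : ℕ → ℝ, Tendsto U atTop (𝓝 (g (m + 1) / (m + 1 : ℕ))) ∧
      ∀ N, 0 < pinSum K (fun i => Y i a) N →
        1 / (N : ℝ) * Real.log (pinSum K (fun i => Y i a) N) ≤ U N :=
    ae_all_iff.2 fun m => hY.ae_tendsto_upper hK hK1 (Nat.succ_pos m)
  have hlower : ∀ᵐ a ∂μ, ∀ j : ℕ, ∃ L : ℕ → ℝ, Tendsto L atTop (𝓝 (e (p + j) / (p + j : ℕ))) ∧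
      ∀ N, p + j ≤ N → 0 < pinSum K (fun i => Y i a) N ∧
        (2 * (p + j) ≤ N → L N ≤ 1 / (N : ℝ) * Real.log (pinSum K (fun i => Y i a) N)) :=
    ae_all_iff.2 fun j => hY.ae_tendsto_lower hK hK1 (hp.trans (Nat.le_add_right p j))
      (hκ0 (2 * (p + j))) (fun q hq => hKpos q ((Nat.le_add_right p j).trans hq))
      (fun q hq hq' => hκ _ q ((Nat.le_add_right p j).trans hq) hq')
  have hconv : ∀ᵐ a ∂μ, Tendsto
      (fun N : ℕ => 1 / (N : ℝ) * Real.log (pinSum K (fun i => Y i a) N)) atTop (𝓝 f) := by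
    have hlogM : Tendsto (fun M : ℕ => Real.log M / M) atTop (𝓝 0) :=
      (Real.isLittleO_log_id_atTop.tendsto_div_nhds_zero).comp tendsto_natCast_atTop_atTop
    have hr : Tendsto (fun M : ℕ => ((1 : ℝ) - 2 * p / M) * f + (2 * (Real.log (κ M) / M) +
        (∫ a, Real.log (Y 0 a) ∂μ) / M - Real.log M / M)) atTop (𝓝 f) := by
      have h1 := ((tendsto_const_nhds (x := (1 : ℝ))).sub
        (tendsto_const_div_atTop_nhds_zero_nat (2 * p : ℝ))).mul_const f
      have h2 := ((hκlim.const_mul 2).add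
        (tendsto_const_div_atTop_nhds_zero_nat (∫ a, Real.log (Y 0 a) ∂μ))).sub hlogM
      simpa using h1.add h2
    filter_upwards [hupper, hlower] with a hu hl
    refine tendsto_order.2 ⟨fun b hb => ?_, fun b hb => ?_⟩
    · obtain ⟨M, hM, hMp⟩ := ((hr.eventually_const_lt hb).and (eventually_ge_atTop (2 * p))).exists
      have hM0 : (0 : ℝ) < M := by exact_mod_cast (by omega : 0 < M)
      have h1 : b < e M / M := by
        refine hM.trans_le ?_
        rw [le_div_iff₀ hM0]
        refine le_trans (le_of_eq ?_) (hcomp M hMp)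
        field_simp
      obtain ⟨j, rfl⟩ := Nat.exists_eq_add_of_le (show p ≤ M by omega)
      obtain ⟨L, hL, hLN⟩ := hl j
      filter_upwards [hL.eventually_const_lt h1, eventually_ge_atTop (2 * (p + j))] with N h2 h3
      exact h2.trans_le ((hLN N (by omega)).2 h3)
    · obtain ⟨m, hm⟩ := exists_lt_of_ciInf_lt hb
      obtain ⟨U, hU, hUN⟩ := hu m
      obtain ⟨L, hL, hLN⟩ := hl 0
      filter_upwards [hU.eventually_lt_const hm, eventually_ge_atTop p] with N h2 h3
      exact (hUN N (hLN N h3).1).trans_lt h2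
  refine ⟨f, hconv, fun m hm => ?_⟩
  -- The bound is deterministic, so one environment satisfying both almost sure statements suffices.
  obtain ⟨a, hc, hl⟩ := (hconv.and hlower).exists
  obtain ⟨j, rfl⟩ := Nat.exists_eq_add_of_le hm
  obtain ⟨L, hL, hLN⟩ := hl j
  have h1 : e (p + j) / (p + j : ℕ) ≤ f := le_of_tendsto_of_tendsto hL hc
    ((eventually_ge_atTop (2 * (p + j))).mono fun N hN => (hLN N (by omega)).2 hN)
  rw [div_le_iff₀ (by exact_mod_cast (by omega : 0 < p + j)), mul_comm] at h1
  refine le_trans ?_ h1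
  rw [← hY.integral_log_apply (p + j - 1)]
  calc _ = ∫ a, (Real.log (Y (p + j - 1) a) + Real.log (K (p + j))) ∂μ := by
        rw [integral_add (hY.integrable_log_apply _) (integrable_const _)]; simp
    _ ≤ e (p + j) := integral_mono ((hY.integrable_log_apply _).add (integrable_const _))
        (hY.integrable_log_pinSum hK hK1 (by omega) (hKpos _ hm))
        fun a => le_log_pinSum hK (hYp a) (by omega) (hKpos _ hm)

end FreeEnergy

/-! ### The homogeneous partition function with weight at most one. -/

section Homogeneous

variable {K : ℕ → ℝ}

lemma sum_range_sub_eq (F : ℕ → ℝ) (d : ℕ) :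
    ∑ k ∈ Finset.range d, F (d - k) = ∑ j ∈ Finset.range d, F (j + 1) := by
  rw [← Finset.sum_range_reflect]
  refine Finset.sum_congr rfl fun k hk => ?_
  have := Finset.mem_range.1 hk
  congr 1; omega

lemma sum_range_sub_le (hKsum : ∀ s : Finset ℕ, ∑ n ∈ s, K n ≤ 1) (d : ℕ) :
    ∑ k ∈ Finset.range d, K (d - k) ≤ 1 := by
  rw [sum_range_sub_eq, ← Finset.sum_image (f := K) (g := fun j => j + 1)
    (fun i _ j _ h => by simpa using h)]
  exact hKsum _

lemma pinSum_const_le_one (hK : ∀ n, 0 ≤ K n) (hKsum : ∀ s : Finset ℕ, ∑ n ∈ s, K n ≤ 1) {q : ℝ}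
    (hq0 : 0 ≤ q) (hq1 : q ≤ 1) (d : ℕ) : pinSum K (fun _ => q) d ≤ 1 := by
  induction d using Nat.strong_induction_on with
  | _ d ih =>
    cases d with
    | zero => simp
    | succ d =>
      rw [pinSum_succ]
      refine mul_le_one₀ hq1 (Finset.sum_nonneg fun k _ =>
        mul_nonneg (pinSum_nonneg hK (fun _ => hq0) k) (hK _)) ?_
      refine le_trans (Finset.sum_le_sum fun k hk => ?_) (sum_range_sub_le hKsum (d + 1))
      exact mul_le_of_le_one_left (hK _) (ih k (Finset.mem_range.1 hk))

/-- Decay of the homogeneous partition function of a renewal with finite mean. -/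
lemma mul_pinSum_const_le (hK : ∀ n, 0 ≤ K n) (hKsum : ∀ s : Finset ℕ, ∑ n ∈ s, K n ≤ 1) {c : ℝ}
    (hc : ∀ d, ∑ j ∈ Finset.range d, ((j + 1 : ℕ) : ℝ) * K (j + 1) ≤ c) {q : ℝ}
    (hq0 : 0 ≤ q) (hq1 : q < 1) (d : ℕ) : d * pinSum K (fun _ => q) d ≤ c / (1 - q) := by
  have hq : 0 < 1 - q := by linarith
  have hc0 : 0 ≤ c := by simpa using hc 0
  induction d using Nat.strong_induction_on with
  | _ d ih =>
    cases d with
    | zero => simp; positivity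
    | succ d =>
      have h1 : ∑ k ∈ Finset.range (d + 1), ((d + 1 : ℕ) : ℝ) *
          (pinSum K (fun _ => q) k * K (d + 1 - k)) ≤ c / (1 - q) * 1 + c := by
        refine le_trans ?_ (add_le_add (mul_le_mul_of_nonneg_left
          (sum_range_sub_le hKsum (d + 1)) (by positivity))
          ((sum_range_sub_eq (fun n => (n : ℝ) * K n) (d + 1)).le.trans (hc (d + 1))))
        rw [Finset.mul_sum, ← Finset.sum_add_distrib]
        refine Finset.sum_le_sum fun k hk => ?_
        have hk' := Finset.mem_range.1 hk
        -- The length is shared between the part up to `k`, bounded by induction and total mass, and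
        -- the last jump, bounded by the mean of `K`.
        have h2 : ((d + 1 : ℕ) : ℝ) = k + ((d + 1 - k : ℕ) : ℝ) := by
          rw [← Nat.cast_add]; congr 1; omega
        have h3 := mul_le_mul_of_nonneg_right (ih k hk') (hK (d + 1 - k))
        have h4 := mul_le_mul_of_nonneg_right (pinSum_const_le_one hK hKsum hq0 hq1.le k)
          (mul_nonneg (Nat.cast_nonneg (α := ℝ) (d + 1 - k)) (hK (d + 1 - k)))
        rw [h2]
        linarith
      rw [pinSum_succ, mul_left_comm, Finset.mul_sum]
      calc _ ≤ q * (c / (1 - q) * 1 + c) := mul_le_mul_of_nonneg_left h1 hq0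
        _ = q * (c / (1 - q)) + q * c := by ring
        _ ≤ q * (c / (1 - q)) + 1 * c := by gcongr
        -- The constant is the fixed point of `x ↦ q * x + c`.
        _ = c / (1 - q) := by field_simp; ring

end Homogeneous

/-! ### Change of measure and fractional moments. -/

section Moments

variable {Ω : Type*} [MeasurableSpace Ω] {μ : Measure Ω} {K : ℕ → ℝ} {X : ℕ → Ω → ℝ}

/-- Factorisation of an expectation at the present coordinate. -/
lemma integral_past_mul (hX : ∀ i, Measurable (X i)) (hind : iIndepFun X μ)
    (hid : ∀ i, IdentDistrib (X i) (X 0) μ μ) {d : ℕ} {A : Ω → ℝ}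
    (hA : Measurable[⨆ i ∈ Set.Iio d, (inferInstance : MeasurableSpace ℝ).comap (X i)] A)
    (hAi : Integrable A μ) {φ : ℝ → ℝ} (hφ : Measurable φ)
    (hφi : Integrable (fun a => φ (X 0 a)) μ) :
    Integrable (fun a => A a * φ (X d a)) μ ∧
      ∫ a, A a * φ (X d a) ∂μ = (∫ a, A a ∂μ) * ∫ a, φ (X 0 a) ∂μ := by
  have h1 : IndepFun A (fun a => φ (X d a)) μ :=
    indepFun_of_measurable_iSup hX hind (s := Set.Iio d) (t := {d}) (by simp) hA
      (hφ.comp (measurable_coordinate X (Set.mem_singleton d)))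
  have h2 := (hid d).comp hφ
  have h3 : Integrable (fun a => φ (X d a)) μ := h2.integrable_iff.2 hφi
  refine ⟨h1.integrable_mul hAi h3, ?_⟩
  rw [h1.integral_fun_mul_eq_mul_integral hAi.aestronglyMeasurable h3.aestronglyMeasurable]
  congr 1
  exact h2.integral_eq

lemma measurable_past_pinSum {Ω : Type*} {X : ℕ → Ω → ℝ} {φ : ℝ → ℝ} (hφ : Measurable φ)
    {k d : ℕ} (hk : k ≤ d) :
    Measurable[⨆ i ∈ Set.Iio d, (inferInstance : MeasurableSpace ℝ).comap (X i)]
      fun a => pinSum K (fun i => φ (X i a)) k :=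
  @measurable_pinSum Ω (_) K (fun i a => φ (X i a)) k fun _ hi =>
    hφ.comp (measurable_coordinate X (Set.mem_Iio.2 (hi.trans_le hk)))

lemma measurable_past_pinSum_mul_prod {Ω : Type*} {X : ℕ → Ω → ℝ} {φ ψ : ℝ → ℝ}
    (hφ : Measurable φ) (hψ : Measurable ψ)
    {k d : ℕ} (hk : k ≤ d) :
    Measurable[⨆ i ∈ Set.Iio d, (inferInstance : MeasurableSpace ℝ).comap (X i)]
      fun a => pinSum K (fun i => φ (X i a)) k * ∏ i ∈ Finset.range d, ψ (X i a) :=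
  (measurable_past_pinSum hφ hk).mul (@Finset.measurable_fun_prod ℝ ℕ Ω _ _ _ (_) _ _ fun _ hi =>
    hψ.comp (measurable_coordinate X (Set.mem_Iio.2 (Finset.mem_range.1 hi))))

/-- Tilting by a product weight turns the averaged partition function into a homogeneous one. -/
lemma integral_pinSum_mul_prod [IsProbabilityMeasure μ] (hX : ∀ i, Measurable (X i))
    (hind : iIndepFun X μ)
    (hid : ∀ i, IdentDistrib (X i) (X 0) μ μ) {φ ψ : ℝ → ℝ} (hφ : Measurable φ)
    (hψ : Measurable ψ) (hψi : Integrable (fun a => ψ (X 0 a)) μ)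
    (hφψ : Integrable (fun a => φ (X 0 a) * ψ (X 0 a)) μ) {v q : ℝ}
    (hv : ∫ a, ψ (X 0 a) ∂μ = v) (hq : ∫ a, φ (X 0 a) * ψ (X 0 a) ∂μ = q * v) (d : ℕ) :
    Integrable (fun a => pinSum K (fun i => φ (X i a)) d * ∏ i ∈ Finset.range d, ψ (X i a)) μ ∧
      ∫ a, pinSum K (fun i => φ (X i a)) d * ∏ i ∈ Finset.range d, ψ (X i a) ∂μ =
        v ^ d * pinSum K (fun _ => q) d := by
  induction d using Nat.strong_induction_on with
  | _ d ih =>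
    -- Sites beyond `k` do not enter the partition function up to `k`, so each extra factor `ψ`
    -- integrates to `v`.
    have hext : ∀ k < d, ∀ e,
        Integrable (fun a => pinSum K (fun i => φ (X i a)) k *
          ∏ i ∈ Finset.range (k + e), ψ (X i a)) μ ∧
        ∫ a, pinSum K (fun i => φ (X i a)) k * ∏ i ∈ Finset.range (k + e), ψ (X i a) ∂μ =
          v ^ (k + e) * pinSum K (fun _ => q) k := by
      intro k hk e
      induction e with
      | zero => exact ih k hk
      | succ e ihe =>
        have := integral_past_mul hX hind hid
          (measurable_past_pinSum_mul_prod (K := K) hφ hψ (Nat.le_add_right k e)) ihe.1 hψ hψi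
        rw [ihe.2, hv] at this
        simp_rw [← add_assoc, Finset.prod_range_succ, ← mul_assoc]
        refine ⟨this.1, this.2.trans ?_⟩
        ring
    cases d with
    | zero => simp
    | succ d =>
      have hterm : ∀ k ∈ Finset.range (d + 1),
          Integrable (fun a => (pinSum K (fun i => φ (X i a)) k *
            ∏ i ∈ Finset.range d, ψ (X i a)) * (φ (X d a) * ψ (X d a))) μ ∧
          ∫ a, (pinSum K (fun i => φ (X i a)) k *
            ∏ i ∈ Finset.range d, ψ (X i a)) * (φ (X d a) * ψ (X d a)) ∂μ =
            v ^ d * pinSum K (fun _ => q) k * (q * v) := by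
        intro k hk
        have hk' := Finset.mem_range.1 hk
        obtain ⟨e, rfl⟩ := Nat.exists_eq_add_of_le (Nat.lt_succ_iff.1 hk')
        have h1 := hext k hk' e
        have h2 := integral_past_mul hX hind hid
          (measurable_past_pinSum_mul_prod (K := K) hφ hψ (Nat.le_add_right k e)) h1.1
          (φ := fun x => φ x * ψ x) (hφ.mul hψ) hφψ
        rw [h1.2, hq] at h2
        exact h2
      have hexp : ∀ a, pinSum K (fun i => φ (X i a)) (d + 1) *
          ∏ i ∈ Finset.range (d + 1), ψ (X i a) = ∑ k ∈ Finset.range (d + 1), K (d + 1 - k) *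
            ((pinSum K (fun i => φ (X i a)) k * ∏ i ∈ Finset.range d, ψ (X i a)) *
              (φ (X d a) * ψ (X d a))) := by
        intro a
        rw [pinSum_succ, Finset.prod_range_succ, Finset.mul_sum, Finset.sum_mul]
        exact Finset.sum_congr rfl fun k _ => by ring
      simp_rw [hexp]
      refine ⟨integrable_finsetSum _ fun k hk => (hterm k hk).1.const_mul _, ?_⟩
      rw [integral_finsetSum _ fun k hk => (hterm k hk).1.const_mul _, pinSum_succ,
        Finset.mul_sum, Finset.mul_sum]
      refine Finset.sum_congr rfl fun k hk => ?_
      rw [integral_const_mul, (hterm k hk).2]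
      ring

lemma integral_prod_pow [IsProbabilityMeasure μ] (hX : ∀ i, Measurable (X i)) (hind : iIndepFun X μ)
    (hid : ∀ i, IdentDistrib (X i) (X 0) μ μ) {ψ : ℝ → ℝ}
    (hψ : Measurable ψ) (hψi : Integrable (fun a => ψ (X 0 a)) μ) (d : ℕ) :
    Integrable (fun a => ∏ i ∈ Finset.range d, ψ (X i a)) μ ∧
      ∫ a, ∏ i ∈ Finset.range d, ψ (X i a) ∂μ = (∫ a, ψ (X 0 a) ∂μ) ^ d := by
  induction d with
  | zero => simp
  | succ d ih =>
    simp_rw [Finset.prod_range_succ]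
    have := integral_past_mul hX hind hid (d := d)
      (A := fun a => ∏ i ∈ Finset.range d, ψ (X i a)) (@Finset.measurable_fun_prod ℝ ℕ Ω _ _ _
          (_) _ _
      fun i hi => hψ.comp (measurable_coordinate X (Set.mem_Iio.2 (Finset.mem_range.1 hi))))
      ih.1 hψ hψi
    rw [ih.2] at this
    exact ⟨this.1, this.2.trans (pow_succ _ _).symm⟩

/-- AM-GM with a free parameter `s`, to be chosen as a function of `d`; it replaces Cauchy-Schwarz
for the tilt. -/
lemma sqrt_mul_le_half {s f g : ℝ} (hs : 0 < s) (hf : 0 ≤ f) (hg : 0 ≤ g) :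
    √(f * g) ≤ (s * f + g / s) / 2 := by
  rw [Real.sqrt_le_left (by positivity)]
  have h1 : f * g = (s * f) * (g / s) := by field_simp
  rw [h1]
  nlinarith [sq_nonneg (s * f - g / s)]

lemma IIDWeights.integrable_sqrt_apply [IsProbabilityMeasure μ] {Y : ℕ → Ω → ℝ}
    (hY : IIDWeights μ Y) :
    Integrable (fun a => √(Y 0 a)) μ := by
  refine Integrable.mono' ((integrable_const (1 : ℝ)).add hY.integrable)
    (hY.measurable 0).sqrt.aestronglyMeasurable (Eventually.of_forall fun a => ?_)
  rw [Real.norm_of_nonneg (Real.sqrt_nonneg _)]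
  have := sqrt_mul_le_half zero_lt_one (hY.pos 0 a).le zero_le_one
  simp only [mul_one, one_mul, div_one, Pi.add_apply] at this ⊢
  linarith [hY.pos 0 a]

lemma IIDWeights.integrable_pinSum [IsProbabilityMeasure μ] {Y : ℕ → Ω → ℝ}
    (hY : IIDWeights μ Y) (K : ℕ → ℝ) (d : ℕ) :
    Integrable (fun a => pinSum K (fun i => Y i a) d) μ ∧
      ∫ a, pinSum K (fun i => Y i a) d ∂μ = pinSum K (fun _ => ∫ a, Y 0 a ∂μ) d := by
  simpa using integral_pinSum_mul_prod (K := K) (φ := id) (ψ := fun _ => 1) (v := 1)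
    (q := ∫ a, Y 0 a ∂μ) hY.measurable hY.indep hY.ident measurable_id measurable_const (by simp)
    (by simpa using hY.integrable) (by simp) (by simp) d

lemma IIDWeights.integrable_sqrt_pinSum [IsProbabilityMeasure μ] {Y : ℕ → Ω → ℝ}
    (hY : IIDWeights μ Y)
    (hK : ∀ n, 0 ≤ K n) (d : ℕ) : Integrable (fun a => √(pinSum K (fun i => Y i a) d)) μ := by
  refine Integrable.mono' ((integrable_const (1 : ℝ)).add (hY.integrable_pinSum K d).1)
    (measurable_pinSum K fun i _ => hY.measurable i).sqrt.aestronglyMeasurable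
    (Eventually.of_forall fun a => ?_)
  have h0 := pinSum_nonneg hK (fun i => (hY.pos i a).le) d
  rw [Real.norm_of_nonneg (Real.sqrt_nonneg _)]
  have := sqrt_mul_le_half zero_lt_one h0 zero_le_one
  simp only [mul_one, one_mul, div_one, Pi.add_apply] at this ⊢
  linarith

lemma sqrt_sum_le_sum_sqrt {ι : Type*} (s : Finset ι) {f : ι → ℝ} (hf : ∀ i, 0 ≤ f i) :
    √(∑ i ∈ s, f i) ≤ ∑ i ∈ s, √(f i) := by
  classical
  induction s using Finset.induction_on with
  | empty => simp
  | insert i s hi ih =>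
    rw [Finset.sum_insert hi, Finset.sum_insert hi]
    refine le_trans ?_ (add_le_add le_rfl ih)
    have h := Finset.sum_nonneg (s := s) fun j _ => hf j
    rw [Real.sqrt_le_left (by positivity), add_sq, Real.sq_sqrt (hf i), Real.sq_sqrt h]
    have : 0 ≤ √(f i) * √(∑ j ∈ s, f j) := by positivity
    linarith

/-- The finite-volume criterion: the fractional moment stays bounded as soon as a certain sum over
the first `k` partition functions is at most one. -/
lemma IIDWeights.integral_sqrt_pinSum_le [IsProbabilityMeasure μ] {Y : ℕ → Ω → ℝ}
    (hY : IIDWeights μ Y)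
    (hK : ∀ n, 0 ≤ K n) {T : ℕ → ℝ} (hT : ∀ i d, ∑ j ∈ Finset.range d, √(K (i + j)) ≤ T i)
    {k : ℕ} (hk : 1 ≤ k) {C : ℝ}
    (hC : ∀ r < k, ∫ a, √(pinSum K (fun i => Y i a) r) ∂μ ≤ C)
    (hρ : (∫ a, √(Y 0 a) ∂μ) * ∑ r ∈ Finset.range k,
      (∫ a, √(pinSum K (fun i => Y i a) r) ∂μ) * T (k - r) ≤ 1) (d : ℕ) :
    ∫ a, √(pinSum K (fun i => Y i a) d) ∂μ ≤ C := by
  set A : ℕ → ℝ := fun r => ∫ a, √(pinSum K (fun i => Y i a) r) ∂μ with hA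
  set s : ℝ := ∫ a, √(Y 0 a) ∂μ with hs
  have hA0 : ∀ r, 0 ≤ A r := fun r => integral_nonneg fun a => Real.sqrt_nonneg _
  have hs0 : 0 ≤ s := integral_nonneg fun a => Real.sqrt_nonneg _
  have hC0 : 0 ≤ C := (hA0 0).trans (hC 0 hk)
  -- The three factors use coordinates before `i`, at `i` and after `i`. Site `n` carries the weight
  -- of index `n - 1`.
  have hfactor : ∀ r i l, r ≤ i →
      Integrable (fun a => (√(pinSum K (fun i => Y i a) r) * √(Y i a)) *
        √(pinSum K (shiftSeq (i + 1) fun i => Y i a) l)) μ ∧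
      ∫ a, (√(pinSum K (fun i => Y i a) r) * √(Y i a)) *
        √(pinSum K (shiftSeq (i + 1) fun i => Y i a) l) ∂μ = A r * s * A l := by
    intro r i l hri
    have h1 := integral_past_mul hY.measurable hY.indep hY.ident (d := i)
      (measurable_past_pinSum (K := K) (φ := id) measurable_id hri).sqrt
      (hY.integrable_sqrt_pinSum hK r) Real.continuous_sqrt.measurable hY.integrable_sqrt_apply
    have h2 : IdentDistrib (fun a => √(pinSum K (shiftSeq (i + 1) fun i => Y i a) l))
        (fun a => √(pinSum K (fun i => Y i a) l)) μ μ :=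
      (hY.identDistrib_shift (i + 1)).comp
        (measurable_pinSum K fun i _ => measurable_pi_apply i).sqrt
    have h3 := h2.integrable_iff.2 (hY.integrable_sqrt_pinSum hK l)
    have h4 : IndepFun (fun a => √(pinSum K (fun i => Y i a) r) * √(Y i a))
        (fun a => √(pinSum K (shiftSeq (i + 1) fun i => Y i a) l)) μ := by
      refine indepFun_of_measurable_iSup hY.measurable hY.indep
        (s := Set.Iio (i + 1)) (t := Set.Ici (i + 1)) ?_
        ((measurable_past_pinSum (K := K) (φ := id) measurable_id (by omega)).sqrt.mul
          (measurable_coordinate Y (Set.mem_Iio.2 (Nat.lt_succ_self i))).sqrt) ?_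
      · rw [Set.disjoint_left]; intro n h1 h2; simp only [Set.mem_Iio, Set.mem_Ici] at h1 h2; omega
      · exact (@measurable_pinSum Ω (_) K (fun j => Y (i + 1 + j)) l fun j _ =>
          measurable_coordinate Y (Set.mem_Ici.2 (Nat.le_add_right _ _))).sqrt
    refine ⟨h4.integrable_mul h1.1 h3, ?_⟩
    rw [h4.integral_fun_mul_eq_mul_integral h1.1.aestronglyMeasurable h3.aestronglyMeasurable,
      h2.integral_eq]
    congr 1
    exact h1.2
  induction d using Nat.strong_induction_on with
  | _ d ih =>
    by_cases hdk : d < k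
    · exact hC d hdk
    obtain ⟨d, rfl⟩ := Nat.exists_eq_add_of_le (not_lt.1 hdk)
    have hpt : ∀ a, √(pinSum K (fun i => Y i a) (k + d)) ≤ ∑ j ∈ Finset.range (d + 1),
        ∑ r ∈ Finset.range k, √(K (k + j - r)) *
          ((√(pinSum K (fun i => Y i a) r) * √(Y (k + j - 1) a)) *
            √(pinSum K (shiftSeq (k + j - 1 + 1) fun i => Y i a) (d - j))) := by
      intro a
      have hy : ∀ i, 0 ≤ Y i a := fun i => (hY.pos i a).le
      have hy' : ∀ l i, 0 ≤ shiftSeq l (fun i => Y i a) i := fun l i => hy _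
      rw [pinSum_add_eq K _ hk d]
      simp_rw [Finset.sum_mul]
      refine (sqrt_sum_le_sum_sqrt _ fun j => Finset.sum_nonneg fun r _ =>
        mul_nonneg (mul_nonneg (mul_nonneg (pinSum_nonneg hK hy _) (hK _)) (hy _))
          (pinSum_nonneg hK (hy' _) _)).trans (Finset.sum_le_sum fun j _ => ?_)
      refine (sqrt_sum_le_sum_sqrt _ fun r =>
        mul_nonneg (mul_nonneg (mul_nonneg (pinSum_nonneg hK hy _) (hK _)) (hy _))
          (pinSum_nonneg hK (hy' _) _)).trans (Finset.sum_le_sum fun r _ => le_of_eq ?_)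
      rw [Real.sqrt_mul (mul_nonneg (mul_nonneg (pinSum_nonneg hK hy _) (hK _)) (hy _)),
        Real.sqrt_mul (mul_nonneg (pinSum_nonneg hK hy _) (hK _)),
        Real.sqrt_mul (pinSum_nonneg hK hy _), show k + j - 1 + 1 = k + j by omega]
      ring
    have hint : ∀ j ∈ Finset.range (d + 1), ∀ r ∈ Finset.range k, Integrable (fun a =>
        √(K (k + j - r)) * ((√(pinSum K (fun i => Y i a) r) * √(Y (k + j - 1) a)) *
            √(pinSum K (shiftSeq (k + j - 1 + 1) fun i => Y i a) (d - j)))) μ :=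
      fun j _ r hr => (hfactor r (k + j - 1) (d - j)
        (by have := Finset.mem_range.1 hr; omega)).1.const_mul _
    have h1 := integral_mono (hY.integrable_sqrt_pinSum hK (k + d))
      (integrable_finsetSum _ fun j hj => integrable_finsetSum _ fun r hr => hint j hj r hr) hpt
    rw [integral_finsetSum _ fun j hj => integrable_finsetSum _ fun r hr => hint j hj r hr] at h1
    refine h1.trans ?_
    calc _ = ∑ j ∈ Finset.range (d + 1), ∑ r ∈ Finset.range k,
          √(K (k + j - r)) * (A r * s * A (d - j)) := by
          refine Finset.sum_congr rfl fun j hj => ?_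
          rw [integral_finsetSum _ fun r hr => hint j hj r hr]
          refine Finset.sum_congr rfl fun r hr => ?_
          rw [integral_const_mul, (hfactor r (k + j - 1) (d - j)
            (by have := Finset.mem_range.1 hr; omega)).2]
      _ ≤ ∑ j ∈ Finset.range (d + 1), ∑ r ∈ Finset.range k,
          √(K (k + j - r)) * (A r * s * C) := by
          refine Finset.sum_le_sum fun j _ => Finset.sum_le_sum fun r _ => ?_
          exact mul_le_mul_of_nonneg_left (mul_le_mul_of_nonneg_left (ih (d - j) (by omega))
            (mul_nonneg (hA0 r) hs0)) (Real.sqrt_nonneg _)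
      -- Summing over the landing site `k + j` of the jump across `k` produces the tail of `√K` from
      -- `k - r` on.
      _ = C * (s * ∑ r ∈ Finset.range k, A r * ∑ j ∈ Finset.range (d + 1), √(K (k - r + j))) := by
          rw [Finset.sum_comm, Finset.mul_sum, Finset.mul_sum]
          refine Finset.sum_congr rfl fun r hr => ?_
          rw [← Finset.sum_mul]
          have : ∀ j ∈ Finset.range (d + 1), √(K (k + j - r)) = √(K (k - r + j)) := by
            intro j _
            have := Finset.mem_range.1 hr
            rw [show k + j - r = k - r + j by omega]
          rw [Finset.sum_congr rfl this]
          ring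
      _ ≤ C * (s * ∑ r ∈ Finset.range k, A r * T (k - r)) := by
          refine mul_le_mul_of_nonneg_left (mul_le_mul_of_nonneg_left
            (Finset.sum_le_sum fun r _ => ?_) hs0) hC0
          exact mul_le_mul_of_nonneg_left (hT _ _) (hA0 r)
      _ ≤ C * 1 := mul_le_mul_of_nonneg_left hρ hC0
      _ = C := mul_one C

end Moments

/-! ### Consequences of the stretched exponential law. -/

section Kernel

variable {K : ℕ → ℝ}

lemma StretchedExponential.exists_bounds (hK : StretchedExponential K) :
    ∃ c > (0 : ℝ), ∃ ζ ∈ Set.Ioo (0 : ℝ) 1, ∃ p ≥ (1 : ℕ), ∀ n : ℕ, n ≥ p →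
      c / 2 * Real.exp (-((n : ℝ) ^ ζ)) ≤ K n ∧ K n ≤ 2 * c * Real.exp (-((n : ℝ) ^ ζ)) := by
  obtain ⟨c, hc, ζ, hζ, h⟩ := hK
  have hv : ∀ n : ℕ, 0 < c * Real.exp (-((n : ℝ) ^ ζ)) := fun n => mul_pos hc (Real.exp_pos _)
  have h1 := (Asymptotics.isEquivalent_iff_tendsto_one
    (Eventually.of_forall fun n => (hv n).ne')).1 h
  obtain ⟨p, hp⟩ := eventually_atTop.1 ((h1.eventually_const_lt (by norm_num : (1 / 2 : ℝ) < 1)).and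
    (h1.eventually_lt_const (by norm_num : (1 : ℝ) < 2)))
  refine ⟨c, hc, ζ, hζ, p + 1, by omega, fun n hn => ?_⟩
  obtain ⟨h2, h3⟩ := hp n (by omega)
  rw [Pi.div_apply, lt_div_iff₀ (hv n)] at h2
  rw [Pi.div_apply, div_lt_iff₀ (hv n)] at h3
  constructor <;> linarith

/-- The profile decreases in `m`, which makes the bound uniform over `q ≤ m`; its logarithm is
sublinear because `ζ < 1`. -/
lemma StretchedExponential.exists_lower (hK : StretchedExponential K) :
    ∃ p ≥ (1 : ℕ), ∃ κ : ℕ → ℝ, (∀ m, 0 < κ m) ∧ (∀ m, κ m ≤ 1) ∧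
      (∀ m q, p ≤ q → q ≤ m → κ m ≤ K q) ∧
      Tendsto (fun m : ℕ => Real.log (κ m) / m) atTop (𝓝 0) := by
  obtain ⟨c, hc, ζ, hζ, p, hp, h⟩ := hK.exists_bounds
  have hm0 : 0 < min 1 (c / 2) := lt_min one_pos (by linarith)
  refine ⟨p, hp, fun m => min 1 (c / 2) * Real.exp (-((m : ℝ) ^ ζ)),
    fun m => mul_pos hm0 (Real.exp_pos _), fun m => ?_, fun m q hpq hqm => ?_, ?_⟩
  · refine mul_le_one₀ (min_le_left _ _) (Real.exp_pos _).le (Real.exp_le_one_iff.2 ?_)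
    have : (0 : ℝ) ≤ (m : ℝ) ^ ζ := by positivity
    linarith
  · refine le_trans ?_ (h q hpq).1
    have : (q : ℝ) ^ ζ ≤ (m : ℝ) ^ ζ :=
      Real.rpow_le_rpow (by positivity) (by exact_mod_cast hqm) hζ.1.le
    exact mul_le_mul (min_le_right _ _) (Real.exp_le_exp.2 (by linarith)) (Real.exp_pos _).le
      (by linarith)
  · have h1 : Tendsto (fun m : ℕ => (m : ℝ) ^ (-(1 - ζ))) atTop (𝓝 0) :=
      (tendsto_rpow_neg_atTop (by linarith [hζ.2])).comp tendsto_natCast_atTop_atTop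
    have h2 := (tendsto_const_div_atTop_nhds_zero_nat (Real.log (min 1 (c / 2)))).sub h1
    rw [sub_zero] at h2
    refine h2.congr' ?_
    filter_upwards [eventually_ge_atTop 1] with m hm
    have hm' : (0 : ℝ) < m := by exact_mod_cast hm
    rw [Real.log_mul hm0.ne' (Real.exp_pos _).ne', Real.log_exp, add_div, neg_div, ← sub_eq_add_neg]
    congr 1
    rw [neg_sub, Real.rpow_sub hm', Real.rpow_one]

/-- The root halves the exponent, which still beats every power. The fourth power leaves tails of
`√K` that are themselves summable. -/
lemma StretchedExponential.exists_sqrt_le (hK : StretchedExponential K) :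
    ∃ C, 0 ≤ C ∧ ∀ n, √(K n) ≤ C / ((n : ℝ) + 1) ^ 4 := by
  obtain ⟨c, hc, ζ, hζ, p, hp, h⟩ := hK.exists_bounds
  have h1 : Tendsto (fun n : ℕ => √(2 * c) * 16 * (((n : ℝ) ^ ζ) ^ (4 / ζ) *
      Real.exp (-(1 / 2) * (n : ℝ) ^ ζ))) atTop (𝓝 0) := by
    have := (tendsto_rpow_mul_exp_neg_mul_atTop_nhds_zero (4 / ζ) (1 / 2) (by norm_num)).comp
      ((tendsto_rpow_atTop hζ.1).comp tendsto_natCast_atTop_atTop)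
    simpa using this.const_mul (√(2 * c) * 16)
  have h2 : Tendsto (fun n : ℕ => √(K n) * ((n : ℝ) + 1) ^ 4) atTop (𝓝 0) := by
    refine tendsto_of_tendsto_of_tendsto_of_le_of_le' tendsto_const_nhds h1
      (Eventually.of_forall fun n => by positivity) ?_
    filter_upwards [eventually_ge_atTop p] with n hn
    have hn1 : (1 : ℝ) ≤ n := by exact_mod_cast hp.trans hn
    have h3 : √(K n) ≤ √(2 * c) * Real.exp (-(1 / 2) * (n : ℝ) ^ ζ) := by
      have h4 : Real.exp (-((n : ℝ) ^ ζ)) = Real.exp (-(1 / 2) * (n : ℝ) ^ ζ) ^ 2 := by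
        rw [← Real.exp_nat_mul]; congr 1; push_cast; ring
      refine (Real.sqrt_le_sqrt (h n hn).2).trans_eq ?_
      rw [Real.sqrt_mul (by positivity), h4, Real.sqrt_sq (Real.exp_pos _).le]
    have h5 : ((n : ℝ) + 1) ^ 4 ≤ 16 * ((n : ℝ) ^ ζ) ^ (4 / ζ) := by
      rw [← Real.rpow_mul (by positivity), mul_div_cancel₀ _ hζ.1.ne',
        show (4 : ℝ) = ((4 : ℕ) : ℝ) by norm_num, Real.rpow_natCast]
      calc ((n : ℝ) + 1) ^ 4 ≤ (2 * n) ^ 4 := by gcongr; linarith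
        _ = _ := by ring
    calc √(K n) * ((n : ℝ) + 1) ^ 4
        ≤ (√(2 * c) * Real.exp (-(1 / 2) * (n : ℝ) ^ ζ)) * (16 * ((n : ℝ) ^ ζ) ^ (4 / ζ)) := by
          gcongr
      _ = _ := by ring
  obtain ⟨C, hC⟩ := h2.bddAbove_range
  have hC' : ∀ n : ℕ, √(K n) * ((n : ℝ) + 1) ^ 4 ≤ C := fun n => hC ⟨n, rfl⟩
  refine ⟨C, le_trans (by positivity) (hC' 0), fun n => ?_⟩
  rw [le_div_iff₀ (by positivity)]
  exact hC' n

lemma exists_sum_sqrt_le {C : ℝ} (hC : 0 ≤ C) (hK : ∀ n, √(K n) ≤ C / ((n : ℝ) + 1) ^ 4) :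
    ∃ D, ∀ i d, ∑ j ∈ Finset.range d, √(K (i + j)) ≤ D / ((i : ℝ) + 1) ^ 2 := by
  have hs : Summable fun j : ℕ => 1 / ((j : ℝ) + 1) ^ 2 := by
    have := (summable_nat_add_iff 1).2 (Real.summable_one_div_nat_pow.2 (by norm_num : 1 < 2))
    simpa using this
  refine ⟨C * ∑' j : ℕ, 1 / ((j : ℝ) + 1) ^ 2, fun i d => ?_⟩
  have h1 : ∀ j : ℕ, √(K (i + j)) ≤ C / ((i : ℝ) + 1) ^ 2 * (1 / ((j : ℝ) + 1) ^ 2) := by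
    intro j
    refine (hK (i + j)).trans ?_
    rw [div_mul_div_comm, mul_one, ← mul_pow]
    refine div_le_div_of_nonneg_left hC (by positivity) ?_
    -- The fourth power is split into a square in `i`, kept as decay of the tail, and a square in
    -- `j`, which is summed.
    have h2 : ((i : ℝ) + 1) * (j + 1) ≤ (((i + j : ℕ) : ℝ) + 1) ^ 2 := by
      push_cast
      nlinarith [(Nat.cast_nonneg i : (0 : ℝ) ≤ i), (Nat.cast_nonneg j : (0 : ℝ) ≤ j)]
    calc (((i : ℝ) + 1) * (j + 1)) ^ 2 ≤ ((((i + j : ℕ) : ℝ) + 1) ^ 2) ^ 2 := by gcongr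
      _ = _ := by ring
  calc _ ≤ ∑ j ∈ Finset.range d, C / ((i : ℝ) + 1) ^ 2 * (1 / ((j : ℝ) + 1) ^ 2) :=
        Finset.sum_le_sum fun j _ => h1 j
    _ = C / ((i : ℝ) + 1) ^ 2 * ∑ j ∈ Finset.range d, (1 / ((j : ℝ) + 1) ^ 2) := by
        rw [Finset.mul_sum]
    _ ≤ C / ((i : ℝ) + 1) ^ 2 * ∑' j : ℕ, 1 / ((j : ℝ) + 1) ^ 2 :=
        mul_le_mul_of_nonneg_left (hs.sum_le_tsum _ fun j _ => by positivity) (by positivity)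
    _ = _ := by ring

lemma exists_mean_le (hK0 : ∀ n, 0 ≤ K n) (hK1 : ∀ n, K n ≤ 1) {C : ℝ}
    (hK : ∀ n, √(K n) ≤ C / ((n : ℝ) + 1) ^ 4) :
    ∃ c, ∀ d, ∑ j ∈ Finset.range d, ((j + 1 : ℕ) : ℝ) * K (j + 1) ≤ c := by
  have hs : Summable fun j : ℕ => C * (1 / (j : ℝ) ^ 3) :=
    (Real.summable_one_div_nat_pow.2 (by norm_num : 1 < 3)).mul_left C
  have hs' := (summable_nat_add_iff 1).2 hs
  have hle : ∀ j : ℕ, ((j + 1 : ℕ) : ℝ) * K (j + 1) ≤ C * (1 / ((j + 1 : ℕ) : ℝ) ^ 3) := by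
    intro j
    have hj : (0 : ℝ) < ((j + 1 : ℕ) : ℝ) := by positivity
    have hC : 0 ≤ C := by
      have := (Real.sqrt_nonneg _).trans (hK 0)
      simpa using this
    have h1 : K (j + 1) ≤ √(K (j + 1)) := Real.le_sqrt_of_sq_le (by
      nlinarith [hK0 (j + 1), hK1 (j + 1)])
    have h2 : C / (((j + 1 : ℕ) : ℝ) + 1) ^ 4 ≤ C / ((j + 1 : ℕ) : ℝ) ^ 4 := by
      gcongr; linarith
    calc _ ≤ ((j + 1 : ℕ) : ℝ) * (C / ((j + 1 : ℕ) : ℝ) ^ 4) :=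
          mul_le_mul_of_nonneg_left (h1.trans ((hK _).trans h2)) hj.le
      _ = _ := by field_simp
  refine ⟨∑' j : ℕ, C * (1 / ((j + 1 : ℕ) : ℝ) ^ 3), fun d =>
    (Finset.sum_le_sum fun j _ => hle j).trans (hs'.sum_le_tsum _ fun j _ => ?_)⟩
  exact (mul_nonneg (Nat.cast_nonneg _) (hK0 _)).trans (hle j)

/-- With `i = k - 1 - r`, each term tends to zero for fixed `i` and is dominated by `T (i + 1)`. -/
lemma tendsto_sum_mul_reflect {A T : ℕ → ℝ} (hA : Tendsto A atTop (𝓝 0)) (hA0 : ∀ n, 0 ≤ A n)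
    (hA1 : ∀ n, A n ≤ 1) (hT0 : ∀ n, 0 ≤ T n) (hT : Summable T) :
    Tendsto (fun k : ℕ => ∑ r ∈ Finset.range k, A r * T (k - r)) atTop (𝓝 0) := by
  have h := tendsto_tsum_of_dominated_convergence (𝓕 := atTop)
    (f := fun (k i : ℕ) => if i < k then A (k - 1 - i) * T (i + 1) else 0) (g := fun _ => 0)
    (bound := fun i => T (i + 1)) ((summable_nat_add_iff 1).2 hT) ?_ ?_
  · rw [tsum_zero] at h
    refine h.congr fun k => ?_
    rw [tsum_eq_sum (s := Finset.range k) fun i hi => if_neg (by simpa using hi),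
      ← Finset.sum_range_reflect]
    refine Finset.sum_congr rfl fun i hi => ?_
    have hi' := Finset.mem_range.1 hi
    rw [if_pos (by omega), show k - 1 - (k - 1 - i) = i by omega,
      show k - 1 - i + 1 = k - i by omega]
  · intro i
    have h1 : Tendsto (fun k : ℕ => k - 1 - i) atTop atTop :=
      (tendsto_sub_atTop_nat i).comp (tendsto_sub_atTop_nat 1)
    have h2 := (hA.comp h1).mul_const (T (i + 1))
    rw [zero_mul] at h2
    refine h2.congr' ?_
    filter_upwards [eventually_gt_atTop i] with k hk
    rw [if_pos hk]; rfl
  · refine Eventually.of_forall fun k i => ?_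
    split_ifs
    · rw [Real.norm_of_nonneg (mul_nonneg (hA0 _) (hT0 _))]
      exact mul_le_of_le_one_left (hT0 _) (hA1 _)
    · simpa using hT0 _

end Kernel

/-! ### Estimates on the moment generating function of the disorder. -/

section MomentGenerating

variable {Ω : Type*} [MeasurableSpace Ω] {μ : Measure Ω} {X : Ω → ℝ}

lemma integrableExpSet_eq_univ (hexp : ∀ b : ℝ, Integrable (fun a => Real.exp (b * X a)) μ) :
    integrableExpSet X μ = Set.univ :=
  Set.eq_univ_of_forall hexp

/-- Centring makes the cumulant generating function vanish to second order at zero, and its second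
derivative is bounded on `[0, 1]`. -/
lemma exists_mgf_le [IsProbabilityMeasure μ] (hexp : ∀ b : ℝ, Integrable (fun a => Real.exp
    (b * X a)) μ)
    (h0 : ∫ a, X a ∂μ = 0) : ∃ C, ∀ t, 0 < t → t ≤ 1 → mgf X μ t ≤ Real.exp (C * t ^ 2) := by
  have huniv := integrableExpSet_eq_univ hexp
  have hcont : Continuous (iteratedDeriv 2 (cgf X μ)) := by
    refine continuous_iff_continuousAt.2 fun t => ?_
    have h1 : AnalyticAt ℝ (cgf X μ) t := analyticAt_cgf (by simp [huniv])
    rw [iteratedDeriv_eq_iterate]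
    exact (h1.iterated_deriv 2).continuousAt
  obtain ⟨C, hC⟩ := (isCompact_Icc (a := (0 : ℝ)) (b := 1)).bddAbove_image hcont.continuousOn
  refine ⟨C / 2, fun t ht ht1 => ?_⟩
  obtain ⟨u, hu, hut⟩ := exists_cgf_eq_iteratedDeriv_two_cgf_mul ht h0 (by simp [huniv])
  have hCu := hC ⟨u, ⟨hu.1.le, hu.2.le.trans ht1⟩, rfl⟩
  rw [← exp_cgf (hexp t), hut]
  refine Real.exp_le_exp.2 ?_
  nlinarith [sq_nonneg t]

/-- The integral equals that of `X (exp (β X) - 1) ≥ 0`, which vanishes almost surely only if `X`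
does, against unit variance. -/
lemma integral_mul_exp_pos [IsProbabilityMeasure μ] (hexp : ∀ b : ℝ, Integrable
    (fun a => Real.exp (b * X a)) μ)
    (h0 : ∫ a, X a ∂μ = 0) (hvar : variance X μ = 1) {β : ℝ} (hβ : 0 < β) :
    0 < ∫ a, X a * Real.exp (β * X a) ∂μ := by
  have huniv := integrableExpSet_eq_univ hexp
  have hi : ∀ b, Integrable (fun a => X a * Real.exp (b * X a)) μ := fun b => by
    simpa using integrable_pow_mul_exp_of_mem_interior_integrableExpSet
      (X := X) (μ := μ) (v := b) (by simp [huniv]) 1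
  have hi0 : Integrable X μ := by simpa using hi 0
  have hnn : ∀ a, 0 ≤ X a * Real.exp (β * X a) - X a := by
    intro a
    have : X a * Real.exp (β * X a) - X a = X a * (Real.exp (β * X a) - 1) := by ring
    rw [this]
    rcases le_total 0 (X a) with h | h
    · exact mul_nonneg h (by linarith [Real.one_le_exp (mul_nonneg hβ.le h)])
    · refine mul_nonneg_of_nonpos_of_nonpos h ?_
      linarith [Real.exp_le_one_iff.2 (mul_nonpos_of_nonneg_of_nonpos hβ.le h)]
  have heq : ∫ a, (X a * Real.exp (β * X a) - X a) ∂μ = ∫ a, X a * Real.exp (β * X a) ∂μ := by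
    rw [integral_sub (hi β) hi0, h0, sub_zero]
  rw [← heq]
  refine lt_of_le_of_ne (integral_nonneg hnn) fun h => ?_
  have h1 := (integral_eq_zero_iff_of_nonneg hnn ((hi β).sub hi0)).1 h.symm
  have h2 : X =ᵐ[μ] 0 := by
    filter_upwards [h1] with a ha
    have ha' : X a * (Real.exp (β * X a) - 1) = 0 := by
      have : X a * Real.exp (β * X a) - X a = 0 := ha
      linarith
    rcases mul_eq_zero.1 ha' with h | h
    · exact h
    · have : β * X a = 0 := by
        rw [← Real.exp_eq_one_iff]; linarith
      simpa [hβ.ne'] using this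
  rw [variance_congr h2] at hvar
  simp at hvar

/-- At `t = 0` the ratio is one and, the denominator being stationary by centring, its derivative is
`-exp (-λ(β)) D < 0`. Half of this slope is kept as `c`. -/
lemma eventually_tilted_le [IsProbabilityMeasure μ] (hexp : ∀ b : ℝ, Integrable
    (fun a => Real.exp (b * X a)) μ)
    (h0 : ∫ a, X a ∂μ = 0) (hvar : variance X μ = 1) {β : ℝ} (hβ : 0 < β) :
    ∃ c > 0, ∀ᶠ t in 𝓝[>] (0 : ℝ),
      Real.exp (-cgf X μ β) * mgf X μ (β - t) / mgf X μ (-t) ≤ 1 - c * t := by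
  have huniv := integrableExpSet_eq_univ hexp
  set D := ∫ a, X a * Real.exp (β * X a) ∂μ with hD
  have hDpos : 0 < D := integral_mul_exp_pos hexp h0 hvar hβ
  have hMpos : ∀ t, 0 < mgf X μ t := fun t => mgf_pos (hexp t)
  have h1 : HasDerivAt (fun t => mgf X μ (β - t)) (-D) 0 := by
    have := (hasDerivAt_mgf (X := X) (μ := μ) (t := β - 0) (by simp [huniv])).comp_const_sub β 0
    simpa [hD] using this
  have h2 : HasDerivAt (fun t => mgf X μ (-t)) 0 0 := by
    have := (hasDerivAt_mgf (X := X) (μ := μ) (t := -0) (by simp [huniv])).scomp 0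
      (hasDerivAt_neg (0 : ℝ))
    simpa [h0, Function.comp_def] using this
  have h3 := (h1.const_mul (Real.exp (-cgf X μ β))).div h2 (hMpos _).ne'
  have hexpc : Real.exp (-cgf X μ β) * mgf X μ β = 1 := by
    rw [← exp_cgf (hexp β), ← Real.exp_add]; simp
  set c := Real.exp (-cgf X μ β) * D / 2 with hc
  have hc0 : 0 < c := by positivity
  refine ⟨c, hc0, ?_⟩
  have h4 := h3.tendsto_slope_zero_right
  have h5 := h4.eventually_lt_const (u := -c) (by
    simp
    have := Real.exp_pos (-cgf X μ β)
    rw [hc]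
    nlinarith)
  filter_upwards [h5, self_mem_nhdsWithin] with t ht htpos
  have htpos' : (0 : ℝ) < t := htpos
  simp only [zero_add, Pi.div_apply, sub_zero, neg_zero, mgf_zero, hexpc, smul_eq_mul, div_one] at ht
  rw [inv_mul_lt_iff₀ htpos'] at ht
  linarith

end MomentGenerating

/-! ### Fractional moments at and slightly above the annealed critical point. -/

section Disorder

variable {Ω : Type*} [MeasurableSpace Ω] {μ : Measure Ω} {K : ℕ → ℝ} {ω : ℕ → Ω → ℝ}

lemma IsDisorder.integrable (hω : IsDisorder μ ω) : Integrable (ω 1) μ := by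
  simpa using integrable_pow_mul_exp_of_mem_interior_integrableExpSet
    (X := ω 1) (μ := μ) (v := 0) (by simp [integrableExpSet_eq_univ hω.integrable_exp]) 1

lemma measurable_expWeight (β h : ℝ) : Measurable fun x : ℝ => Real.exp (β * x + h) := by
  fun_prop

lemma IsDisorder.iidWeights [IsProbabilityMeasure μ] (hω : IsDisorder μ ω) (β h : ℝ) :
    IIDWeights μ fun i a => Real.exp (β * ω (i + 1) a + h) where
  measurable i := (measurable_expWeight β h).comp (hω.measurable i)
  indep := hω.indep.comp (fun _ x => Real.exp (β * x + h)) fun _ => measurable_expWeight β h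
  ident i := (hω.ident i).comp (measurable_expWeight β h)
  pos i a := Real.exp_pos _
  integrable := by
    simp_rw [Real.exp_add]
    exact (hω.integrable_exp β).mul_const _
  integrable_log := by
    simp_rw [Real.log_exp]
    exact (hω.integrable.const_mul β).add (integrable_const h)

lemma IsDisorder.integral_log [IsProbabilityMeasure μ] (hω : IsDisorder μ ω) (β h : ℝ) :
    ∫ a, Real.log (Real.exp (β * ω (0 + 1) a + h)) ∂μ = h := by
  simp_rw [Real.log_exp, zero_add]
  rw [integral_add (hω.integrable.const_mul β) (integrable_const h), integral_const_mul,
    hω.mean_zero]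
  simp

/-- The fractional moment estimate obtained by tilting the environment by `-t`. -/
lemma IsDisorder.integral_sqrt_pinSum_le_tilt [IsProbabilityMeasure μ] (hω : IsDisorder μ ω)
    (hK : ∀ n, 0 ≤ K n)
    (β h t : ℝ) {s : ℝ} (hs : 0 < s) (d : ℕ) :
    ∫ a, √(pinSum K (fun i => Real.exp (β * ω (i + 1) a + h)) d) ∂μ ≤
      (s * (mgf (ω 1) μ (-t) ^ d * pinSum K
        (fun _ => Real.exp h * mgf (ω 1) μ (β - t) / mgf (ω 1) μ (-t)) d) +
        mgf (ω 1) μ t ^ d / s) / 2 := by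
  have hM : mgf (ω 1) μ (-t) ≠ 0 := (mgf_pos (hω.integrable_exp (-t))).ne'
  have hprod : ∀ x, Real.exp (β * x + h) * Real.exp (-t * x) =
      Real.exp h * Real.exp ((β - t) * x) := fun x => by
    rw [← Real.exp_add, ← Real.exp_add]; congr 1; ring
  have h1 := integral_pinSum_mul_prod (K := K) (X := fun i => ω (i + 1))
    (φ := fun x => Real.exp (β * x + h)) (ψ := fun x => Real.exp (-t * x))
    (v := mgf (ω 1) μ (-t)) (q := Real.exp h * mgf (ω 1) μ (β - t) / mgf (ω 1) μ (-t))
    hω.measurable hω.indep hω.ident (measurable_expWeight β h) (by fun_prop)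
    (hω.integrable_exp (-t)) (by simp_rw [hprod]; exact (hω.integrable_exp (β - t)).const_mul _)
    rfl (by simp_rw [hprod]; rw [integral_const_mul, div_mul_cancel₀ _ hM]; rfl) d
  have h2 := integral_prod_pow (X := fun i => ω (i + 1)) (ψ := fun x => Real.exp (t * x))
    hω.measurable hω.indep hω.ident (by fun_prop) (hω.integrable_exp t) d
  rw [← h1.2, show mgf (ω 1) μ t ^ d = _ from h2.2.symm]
  -- The tilting product and its inverse multiply to one, so `Z` is unchanged when both are inserted
  -- under the root.
  have hpt : ∀ a, √(pinSum K (fun i => Real.exp (β * ω (i + 1) a + h)) d) ≤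
      (s * (pinSum K (fun i => Real.exp (β * ω (i + 1) a + h)) d *
        ∏ i ∈ Finset.range d, Real.exp (-t * ω (i + 1) a)) +
        (∏ i ∈ Finset.range d, Real.exp (t * ω (i + 1) a)) / s) / 2 := by
    intro a
    refine le_trans (le_of_eq ?_) (sqrt_mul_le_half hs
      (mul_nonneg (pinSum_nonneg hK (fun i => (Real.exp_pos _).le) d)
        (Finset.prod_nonneg fun i _ => (Real.exp_pos _).le))
      (Finset.prod_nonneg fun i _ => (Real.exp_pos _).le))
    rw [mul_assoc, ← Finset.prod_mul_distrib]
    simp_rw [← Real.exp_add]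
    simp
  have hi1 := h1.1.const_mul s
  have hi2 := h2.1.div_const s
  refine (integral_mono ((hω.iidWeights β h).integrable_sqrt_pinSum hK d)
    ((hi1.add hi2).div_const 2) hpt).trans_eq ?_
  rw [integral_div]
  congr 1
  refine (integral_add hi1 hi2).trans ?_
  rw [integral_const_mul, integral_div]

/-- At the annealed critical point the fractional moment of the partition function vanishes in the
limit. -/
lemma IsDisorder.tendsto_integral_sqrt_pinSum [IsProbabilityMeasure μ] (hω : IsDisorder μ ω)
    (hK : ∀ n, 0 ≤ K n)
    (hKsum : ∀ s : Finset ℕ, ∑ n ∈ s, K n ≤ 1) {c : ℝ}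
    (hc : ∀ d, ∑ j ∈ Finset.range d, ((j + 1 : ℕ) : ℝ) * K (j + 1) ≤ c) {β : ℝ} (hβ : 0 < β) :
    Tendsto (fun d => ∫ a, √(pinSum K
      (fun i => Real.exp (β * ω (i + 1) a + -cgf (ω 1) μ β)) d) ∂μ) atTop (𝓝 0) := by
  have hc0 : 0 ≤ c := by simpa using hc 0
  obtain ⟨C₁, hC₁⟩ := exists_mgf_le hω.integrable_exp hω.mean_zero
  obtain ⟨C₂, hC₂⟩ := exists_mgf_le (X := -ω 1) (μ := μ)
    (fun b => by simpa using hω.integrable_exp (-b))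
    (by simp only [Pi.neg_apply]; rw [integral_neg, hω.mean_zero, neg_zero])
  simp_rw [mgf_neg] at hC₂
  obtain ⟨e, he, hev⟩ := eventually_tilted_le hω.integrable_exp hω.mean_zero hω.variance_one hβ
  have hsq : Tendsto (fun d : ℕ => √(d : ℝ)) atTop atTop :=
    Real.tendsto_sqrt_atTop.comp tendsto_natCast_atTop_atTop
  have ht : Tendsto (fun d : ℕ => (√(d : ℝ))⁻¹) atTop (𝓝[>] 0) :=
    tendsto_inv_atTop_nhdsGT_zero.comp hsq
  have hss : Tendsto (fun d : ℕ => √√(d : ℝ)) atTop atTop := Real.tendsto_sqrt_atTop.comp hsq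
  have hlim : Tendsto (fun d : ℕ => (Real.exp C₂ * (c / e) + Real.exp C₁) / 2 * (√√(d : ℝ))⁻¹)
      atTop (𝓝 0) := by
    simpa using (tendsto_inv_atTop_zero.comp hss).const_mul
      ((Real.exp C₂ * (c / e) + Real.exp C₁) / 2)
  refine tendsto_of_tendsto_of_tendsto_of_le_of_le' tendsto_const_nhds hlim
    (Eventually.of_forall fun d => integral_nonneg fun a => Real.sqrt_nonneg _) ?_
  filter_upwards [ht.eventually hev, eventually_ge_atTop 1] with d hd hd1
  have hd1' : (1 : ℝ) ≤ d := by exact_mod_cast hd1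
  have hd0 : (0 : ℝ) < d := by linarith
  -- This size gives `t ^ 2 * d = 1`: the tilt costs a bounded factor, while `1 - q` is at least of
  -- order `d ^ (-1/2)`.
  set t := (√(d : ℝ))⁻¹ with ht_def
  have hsd : 1 ≤ √(d : ℝ) := Real.one_le_sqrt.2 hd1'
  have ht0 : 0 < t := inv_pos.2 (by linarith)
  have ht1 : t ≤ 1 := inv_le_one_of_one_le₀ hsd
  have htd : t ^ 2 * d = 1 := by
    rw [ht_def, inv_pow, Real.sq_sqrt hd0.le, inv_mul_cancel₀ hd0.ne']
  -- The choice `d ^ (1/4)` balances the AM-GM terms: `s * t` and `1 / s` coincide.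
  set s := √√(d : ℝ) with hs_def
  have hs : 0 < s := Real.sqrt_pos.2 (by linarith)
  have hs2 : s * s = √(d : ℝ) := Real.mul_self_sqrt (by linarith)
  set q := Real.exp (-cgf (ω 1) μ β) * mgf (ω 1) μ (β - t) / mgf (ω 1) μ (-t) with hq
  have hq0 : 0 ≤ q := div_nonneg (mul_nonneg (Real.exp_pos _).le mgf_nonneg) mgf_nonneg
  have hq1 : e * t ≤ 1 - q := by linarith
  have hqt : 0 < e * t := mul_pos he ht0
  have hb := mul_pinSum_const_le hK hKsum hc hq0 (by linarith) d
  have hb' : pinSum K (fun _ => q) d ≤ (c / e) * t := by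
    have h1 : c / (1 - q) ≤ c / (e * t) := div_le_div_of_nonneg_left hc0 hqt hq1
    have h2 : c / (e * t) = d * ((c / e) * t) := by
      have h3 : (c / e) = (c / e) * (t ^ 2 * d) := by rw [htd, mul_one]
      rw [← div_div, div_eq_iff ht0.ne']
      linear_combination h3
    exact le_of_mul_le_mul_left (hb.trans (h1.trans_eq h2)) hd0
  have hpow : ∀ {M C : ℝ}, 0 ≤ M → M ≤ Real.exp (C * t ^ 2) → M ^ d ≤ Real.exp C := by
    intro M C hM h
    refine (pow_le_pow_left₀ hM h d).trans_eq ?_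
    rw [← Real.exp_nat_mul]
    congr 1
    linear_combination C * htd
  refine (hω.integral_sqrt_pinSum_le_tilt hK β _ t hs d).trans ?_
  have h1 : mgf (ω 1) μ (-t) ^ d * pinSum K (fun _ => q) d ≤ Real.exp C₂ * ((c / e) * t) :=
    mul_le_mul (hpow mgf_nonneg (hC₂ t ht0 ht1)) hb' (pinSum_nonneg hK (fun _ => hq0) d)
      (Real.exp_pos _).le
  have h2 : mgf (ω 1) μ t ^ d ≤ Real.exp C₁ := hpow mgf_nonneg (hC₁ t ht0 ht1)
  have hst : s * t = s⁻¹ := by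
    rw [ht_def, ← hs2]; field_simp
  calc _ ≤ (s * (Real.exp C₂ * ((c / e) * t)) + Real.exp C₁ / s) / 2 := by gcongr
    _ = (Real.exp C₂ * (c / e) * (s * t) + Real.exp C₁ * s⁻¹) / 2 := by ring
    _ = _ := by rw [hst]; ring

/-- Without tilt and with `s = 1` the bound is `(E Z + 1) / 2`, and `E Z ≤ 1` because the averaged
contact weight is one. -/
lemma IsDisorder.integral_sqrt_pinSum_le_one [IsProbabilityMeasure μ] (hω : IsDisorder μ ω)
    (hK : ∀ n, 0 ≤ K n)
    (hKsum : ∀ s : Finset ℕ, ∑ n ∈ s, K n ≤ 1) (β : ℝ) (d : ℕ) :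
    ∫ a, √(pinSum K (fun i => Real.exp (β * ω (i + 1) a + -cgf (ω 1) μ β)) d) ∂μ ≤ 1 := by
  refine (hω.integral_sqrt_pinSum_le_tilt hK β _ 0 one_pos d).trans ?_
  have h1 : Real.exp (-cgf (ω 1) μ β) * mgf (ω 1) μ β = 1 := by
    rw [← exp_cgf (hω.integrable_exp β), ← Real.exp_add]; simp
  have h2 := pinSum_const_le_one hK hKsum zero_le_one le_rfl d
  simp only [neg_zero, sub_zero, mgf_zero, h1, one_pow, div_one, one_mul]
  linarith

/-- The fractional moments of the partition functions stay bounded in a neighbourhood of the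
annealed critical point. -/
lemma IsDisorder.exists_integral_sqrt_pinSum_le [IsProbabilityMeasure μ] (hω : IsDisorder μ ω)
    (hK : ∀ n, 0 ≤ K n)
    (hKsum : ∀ s : Finset ℕ, ∑ n ∈ s, K n ≤ 1) {C : ℝ} (hC : 0 ≤ C)
    (hKC : ∀ n, √(K n) ≤ C / ((n : ℝ) + 1) ^ 4) {β : ℝ} (hβ : 0 < β) :
    ∃ ε > 0, ∃ B : ℝ, ∀ d, ∫ a, √(pinSum K
      (fun i => Real.exp (β * ω (i + 1) a + (-cgf (ω 1) μ β + ε))) d) ∂μ ≤ B := by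
  have hK1 : ∀ n, K n ≤ 1 := fun n => by simpa using hKsum {n}
  obtain ⟨c, hc⟩ := exists_mean_le hK hK1 hKC
  obtain ⟨D, hD⟩ := exists_sum_sqrt_le hC hKC
  have hD0 : 0 ≤ D := by simpa using hD 0 0
  set T : ℕ → ℝ := fun i => D / ((i : ℝ) + 1) ^ 2 with hT
  have hT0 : ∀ i, 0 ≤ T i := fun i => by positivity
  have hTs : Summable T := by
    have := ((summable_nat_add_iff 1).2
      (Real.summable_one_div_nat_pow.2 (by norm_num : 1 < 2))).mul_left D
    simpa [hT, div_eq_mul_inv] using this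
  set h₀ := -cgf (ω 1) μ β with hh₀
  set A : ℕ → ℝ := fun d => ∫ a, √(pinSum K (fun i => Real.exp (β * ω (i + 1) a + h₀)) d) ∂μ
    with hA
  set s : ℝ := ∫ a, √(Real.exp (β * ω (0 + 1) a + h₀)) ∂μ with hs
  have hA0 : ∀ d, 0 ≤ A d := fun d => integral_nonneg fun a => Real.sqrt_nonneg _
  have hs0 : 0 ≤ s := integral_nonneg fun a => Real.sqrt_nonneg _
  have hA1 : ∀ d, A d ≤ 1 := hω.integral_sqrt_pinSum_le_one hK hKsum β
  have hlim := (tendsto_sum_mul_reflect (hω.tendsto_integral_sqrt_pinSum hK hKsum hc hβ)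
    hA0 hA1 hT0 hTs).const_mul s
  rw [mul_zero] at hlim
  -- The criterion holds at the annealed point with a factor two to spare.
  obtain ⟨k, hk, hk1⟩ := ((hlim.eventually_lt_const (by norm_num : (0 : ℝ) < 1 / 2)).and
    (eventually_ge_atTop 1)).exists
  -- Raising `h` by `ε` multiplies the criterion by at most `exp ε ^ (k + 1) = 2`: `k` factors from
  -- the sites, one from the crossing contact.
  set ε : ℝ := Real.log 2 / (k + 1 : ℕ) with hε
  have hε0 : 0 < ε := div_pos (Real.log_pos (by norm_num)) (by positivity)
  have hεk : Real.exp ε ^ (k + 1) = 2 := by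
    rw [← Real.exp_nat_mul, hε, mul_div_cancel₀ _ (by positivity), Real.exp_log (by norm_num)]
  have he1 : 1 ≤ Real.exp ε := Real.one_le_exp hε0.le
  have hsqrt : ∀ x : ℝ, 1 ≤ x → √x ≤ x := fun x hx => by
    rw [Real.sqrt_le_left (by linarith)]; nlinarith
  have hsplit : ∀ x : ℝ, Real.exp (β * x + (h₀ + ε)) = Real.exp ε * Real.exp (β * x + h₀) :=
    fun x => by rw [← Real.exp_add]; congr 1; ring
  have hY := hω.iidWeights β h₀
  have hY' := hω.iidWeights β (h₀ + ε)
  have hA' : ∀ r ≤ k, ∫ a, √(pinSum K (fun i => Real.exp (β * ω (i + 1) a + (h₀ + ε))) r) ∂μ ≤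
      Real.exp ε ^ k * A r := by
    intro r hr
    rw [hA, ← integral_const_mul]
    refine integral_mono (hY'.integrable_sqrt_pinSum hK r)
      ((hY.integrable_sqrt_pinSum hK r).const_mul _) fun a => ?_
    have hy : ∀ i, 0 ≤ Real.exp (β * ω (i + 1) a + h₀) := fun i => (Real.exp_pos _).le
    have h1 := pinSum_const_mul_le he1 hK hy r
    have h2 : Real.exp ε ^ r ≤ Real.exp ε ^ k := pow_le_pow_right₀ he1 hr
    simp_rw [hsplit]
    calc _ ≤ √(Real.exp ε ^ k * pinSum K (fun i => Real.exp (β * ω (i + 1) a + h₀)) r) :=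
          Real.sqrt_le_sqrt (h1.trans (mul_le_mul_of_nonneg_right h2 (pinSum_nonneg hK hy r)))
      _ = √(Real.exp ε ^ k) * √(pinSum K (fun i => Real.exp (β * ω (i + 1) a + h₀)) r) :=
          Real.sqrt_mul (by positivity) _
      _ ≤ _ := mul_le_mul_of_nonneg_right (hsqrt _ (one_le_pow₀ he1)) (Real.sqrt_nonneg _)
  have hs' : ∫ a, √(Real.exp (β * ω (0 + 1) a + (h₀ + ε))) ∂μ ≤ Real.exp ε * s := by
    rw [hs, ← integral_const_mul]
    refine integral_mono hY'.integrable_sqrt_apply (hY.integrable_sqrt_apply.const_mul _)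
      fun a => ?_
    simp_rw [hsplit]
    rw [Real.sqrt_mul (Real.exp_pos _).le]
    exact mul_le_mul_of_nonneg_right (hsqrt _ he1) (Real.sqrt_nonneg _)
  refine ⟨ε, hε0, 2, hY'.integral_sqrt_pinSum_le hK hD hk1 (fun r hr => ?_) ?_⟩
  · refine (hA' r hr.le).trans ((mul_le_of_le_one_right (by positivity) (hA1 r)).trans ?_)
    rw [← hεk]
    exact pow_le_pow_right₀ he1 (Nat.le_succ k)
  · calc _ ≤ (Real.exp ε * s) * ∑ r ∈ Finset.range k, (Real.exp ε ^ k * A r) * T (k - r) := by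
          refine mul_le_mul hs' (Finset.sum_le_sum fun r hr => ?_)
            (Finset.sum_nonneg fun r _ => mul_nonneg
              (integral_nonneg fun a => Real.sqrt_nonneg _) (hT0 _)) (by positivity)
          exact mul_le_mul_of_nonneg_right (hA' r (Finset.mem_range.1 hr).le) (hT0 _)
      _ = Real.exp ε ^ (k + 1) * (s * ∑ r ∈ Finset.range k, A r * T (k - r)) := by
          simp_rw [mul_assoc]
          rw [← Finset.mul_sum]
          ring
      _ ≤ 1 := by rw [hεk]; linarith

/-- Bounded fractional moments force a non-positive exponential growth rate. -/
lemma rate_nonpos_of_integral_sqrt_le [NeZero μ] {Z : ℕ → Ω → ℝ} (hZ : ∀ N a, 0 ≤ Z N a)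
    (hZi : ∀ N, Integrable (fun a => √(Z N a)) μ) {B f : ℝ}
    (hB : ∀ N, ∫ a, √(Z N a) ∂μ ≤ B)
    (hf : ∀ᵐ a ∂μ, Tendsto (fun N : ℕ => 1 / (N : ℝ) * Real.log (Z N a)) atTop (𝓝 f)) :
    f ≤ 0 := by
  by_contra! hf0
  -- A positive rate would send `√Z` to infinity almost surely, contradicting Fatou's lemma and the
  -- bound `B`.
  have hinf : ∀ᵐ a ∂μ, liminf (fun N => ENNReal.ofReal √(Z N a)) atTop = ⊤ := by
    filter_upwards [hf] with a ha
    have h1 : Tendsto (fun N : ℕ => Real.log (Z N a)) atTop atTop := by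
      refine (ha.pos_mul_atTop hf0 tendsto_natCast_atTop_atTop).congr' ?_
      filter_upwards [eventually_ge_atTop 1] with N hN
      have : (N : ℝ) ≠ 0 := by positivity
      field_simp
    have h2 : Tendsto (fun N : ℕ => Z N a) atTop atTop :=
      tendsto_atTop_mono (fun N => Real.log_le_self (hZ N a)) h1
    exact (ENNReal.tendsto_ofReal_atTop.comp (Real.tendsto_sqrt_atTop.comp h2)).liminf_eq
  have h3 : ∫⁻ a, liminf (fun N => ENNReal.ofReal √(Z N a)) atTop ∂μ ≤ ENNReal.ofReal B := by
    refine (lintegral_liminf_le' fun N =>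
        (hZi N).aestronglyMeasurable.aemeasurable.ennreal_ofReal).trans ?_
    refine liminf_le_of_le (by isBoundedDefault) fun b hb => ?_
    obtain ⟨N, hN⟩ := hb.exists
    refine hN.trans ?_
    rw [← ofReal_integral_eq_lintegral_ofReal (hZi N)
      (Eventually.of_forall fun a => Real.sqrt_nonneg _)]
    exact ENNReal.ofReal_le_ofReal (hB N)
  rw [lintegral_congr_ae hinf, lintegral_const, ENNReal.top_mul
    (by simpa using NeZero.ne μ)] at h3
  exact absurd h3 (by simp)

end Disorder

end Pinning

/-! ### Comparison of the quenched and annealed critical points. -/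

theorem proposition1p1 {S Ω : Type*} [MeasurableSpace S] [MeasurableSpace Ω]
    (P : Measure S) [IsProbabilityMeasure P] (τ : ℕ → S → ℕ)
    (μ : Measure Ω) [IsProbabilityMeasure μ] (ω : ℕ → Ω → ℝ)
    (hτ : Pinning.IsRenewal P τ)
    (hK : Pinning.StretchedExponential (Pinning.interArrival P τ))
    (hω : Pinning.IsDisorder μ ω)
    (β : ℝ) (hβ : 0 < β) :
    (∀ h : ℝ, ∃ f : ℝ, Pinning.IsFreeEnergy P τ μ ω β h f) ∧
    (Pinning.pinnedPhase P τ μ ω β).Nonempty ∧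
    BddBelow (Pinning.pinnedPhase P τ μ ω β) ∧
    -(cgf (ω 1) μ β) < Pinning.criticalPoint P τ μ ω β := by
  set K := Pinning.interArrival P τ with hKdef
  have hK0 : ∀ n, 0 ≤ K n := fun n => measureReal_nonneg
  have hKsum : ∀ s : Finset ℕ, ∑ n ∈ s, K n ≤ 1 := hτ.sum_interArrival_le
  have hK1 : ∀ n, K n ≤ 1 := fun n => measureReal_le_one
  obtain ⟨p, hp, κ, hκ0, hκ1, hκ, hκlim⟩ := hK.exists_lower
  obtain ⟨C, hC, hKC⟩ := hK.exists_sqrt_le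
  have hfree : ∀ h : ℝ, ∃ f : ℝ, Pinning.IsFreeEnergy P τ μ ω β h f ∧
      h + Real.log (K p) ≤ p * f := by
    intro h
    obtain ⟨f, hf, hlow⟩ :=
      (hω.iidWeights β h).exists_freeEnergy hK0 hK1 hp hκ0 hκ1 hκ hκlim
    have := hlow p le_rfl
    rw [hω.integral_log] at this
    refine ⟨f, ?_, this⟩
    simp only [Pinning.IsFreeEnergy, hτ.partitionFunction_eq]
    exact hf
  obtain ⟨ε, hε, B, hB⟩ := hω.exists_integral_sqrt_pinSum_le hK0 hKsum hC hKC hβ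
  -- Monotonicity in `h` transfers the fractional moment bound at `-λ(β) + ε` to every smaller `h`,
  -- excluding positive free energy.
  have hbound : -cgf (ω 1) μ β + ε ∈ lowerBounds (Pinning.pinnedPhase P τ μ ω β) := by
    rintro h ⟨f, hf, hf0⟩
    by_contra! hlt
    simp only [Pinning.IsFreeEnergy, hτ.partitionFunction_eq] at hf
    refine absurd hf0 (not_lt.2 (Pinning.rate_nonpos_of_integral_sqrt_le (B := B)
      (fun N a => Pinning.pinSum_nonneg hK0 (fun i => (Real.exp_pos _).le) N)
      ((hω.iidWeights β h).integrable_sqrt_pinSum hK0) (fun N => ?_) hf))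
    refine (integral_mono ((hω.iidWeights β h).integrable_sqrt_pinSum hK0 N)
      ((hω.iidWeights β _).integrable_sqrt_pinSum hK0 N) fun a => ?_).trans (hB N)
    exact Real.sqrt_le_sqrt (Pinning.pinSum_mono hK0 (fun i => (Real.exp_pos _).le)
      (fun i => Real.exp_le_exp.2 (by linarith)) N)
  have hne : (Pinning.pinnedPhase P τ μ ω β).Nonempty := by
    -- With this `h` the one-jump bound reads `1 ≤ p * f`.
    obtain ⟨f, hf, hlow⟩ := hfree (1 - Real.log (K p))
    refine ⟨_, f, hf, ?_⟩
    have h1 : (0 : ℝ) < p := by exact_mod_cast hp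
    by_contra! hf0
    have := mul_nonpos_of_nonneg_of_nonpos h1.le hf0
    linarith
  refine ⟨fun h => (hfree h).imp fun f hf => hf.1, hne, ⟨_, hbound⟩, ?_⟩
  have := le_csInf hne hbound
  rw [Pinning.criticalPoint]
  linarith
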